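/- Let $A$ be a finite alphabet and let $\mathcal{C}$ be a finite set of languages over $A$ which is a quotient-closed Boolean algebra, i.e. $\mathcal{C}$ is closed under union, intersection and complement, and $w^{-1}L=\{u\in A^* \mid wu\in L\}$ and $Lw^{-1}=\{u\in A^*\mid uw\in L\}$ belong to $\mathcal{C}$ for all $L\in\mathcal{C}$ and $w\in A^*$. Let $SF(\mathcal{C})$ be the star-free closure of $\mathcal{C}$: the least class of languages containing $\mathcal{C}$ and the singletons $\{a\}$ for $a\in A$, and closed under union, intersection, complement and concatenation. Then the following three problems, whose inputs are regular languages given by nondeterministic finite automata, are decidable: 1. Membership: given a regular language $L$, is $L\in SF(\mathcal{C})$? 2. Separation: given regular languages $L_1,L_2$, is there $K\in SF(\mathcal{C})$ such that $L_1\subseteq K$ and $K\cap L_2=\emptyset$? 3. Covering: given a regular language $L_1$ and a finite set $\mathbf{L}_2$ of regular languages, is there a finite set $\mathbf{K}\subseteq SF(\mathcal{C})$ such that $L_1\subseteq\bigcup_{K\in\mathbf{K}}K$ and every $K\in\mathbf{K}$ satisfies $K\cap L=\emptyset$ for some $L\in\mathbf{L}_2$? Moreover, covering is decidable for the class of star-free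 languages over $A$, which is the star-free closure of the class of all finite languages over $A$. -/

import Mathlib

/-! ### Classes of languages over a finite alphabet -/

/-- A class of languages closed under union, intersection and complement. -/
structure IsBooleanAlgebraClass {A : Type*} (C : Set (Language A)) : Prop where
  union_mem : ∀ K ∈ C, ∀ L ∈ C, K ⊔ L ∈ C
  inter_mem : ∀ K ∈ C, ∀ L ∈ C, K ⊓ L ∈ C
  compl_mem : ∀ L ∈ C, Lᶜ ∈ C

/-- A class of languages closed under all left quotients `w⁻¹L = {u | wu ∈ L}` and all right
quotients `Lw⁻¹ = {u | uw ∈ L}`. -/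
structure IsQuotientClosed {A : Type*} (C : Set (Language A)) : Prop where
  left_mem : ∀ L ∈ C, ∀ w : List A, ({u | w ++ u ∈ L} : Language A) ∈ C
  right_mem : ∀ L ∈ C, ∀ w : List A, ({u | u ++ w ∈ L} : Language A) ∈ C

/-- Membership in the star-free closure of `C`: the least class containing `C` and the singletons
`{a}` for letters `a`, and closed under Boolean operations and concatenation. -/
inductive InStarFreeClosure {A : Type*} (C : Set (Language A)) : Language A → Prop
  | basic (L : Language A) : L ∈ C → InStarFreeClosure C L
  | letter (a : A) : InStarFreeClosure C {[a]}
  | union (K L : Language A) :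
      InStarFreeClosure C K → InStarFreeClosure C L → InStarFreeClosure C (K ⊔ L)
  | inter (K L : Language A) :
      InStarFreeClosure C K → InStarFreeClosure C L → InStarFreeClosure C (K ⊓ L)
  | compl (L : Language A) : InStarFreeClosure C L → InStarFreeClosure C Lᶜ
  | concat (K L : Language A) :
      InStarFreeClosure C K → InStarFreeClosure C L → InStarFreeClosure C (K * L)

/-- The star-free closure `SF(C)`. -/
def starFreeClosure {A : Type*} (C : Set (Language A)) : Set (Language A) :=
  {L | InStarFreeClosure C L}

/-- The star-free languages: the star-free closure of the class of all finite languages. -/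
def starFreeLanguages (A : Type*) : Set (Language A) :=
  starFreeClosure {L : Language A | {w : List A | w ∈ L}.Finite}

/-! ### Separation and covering -/

/-- `L₁` is `C`-separable from `L₂`. -/
def IsClassSeparable {A : Type*} (C : Set (Language A)) (L₁ L₂ : Language A) : Prop :=
  ∃ K ∈ C, L₁ ≤ K ∧ L₂ ⊓ K = ⊥

/-- `Ks` is a `C`-cover of `L`: a finite set of languages from `C` whose union includes `L`. -/
structure IsCover {A : Type*} (C : Set (Language A)) (L : Language A) (Ks : Set (Language A)) :
    Prop where
  finite : Ks.Finite
  subset_class : Ks ⊆ C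
  le_union : L ≤ sSup Ks

/-- `(L₁, Ls)` is `C`-coverable: some `C`-cover `Ks` of `L₁` is such that each `K ∈ Ks` is disjoint
from at least one `L ∈ Ls`. -/
def IsCoverable {A : Type*} (C : Set (Language A)) (L₁ : Language A) (Ls : Set (Language A)) :
    Prop :=
  ∃ Ks : Set (Language A), IsCover C L₁ Ks ∧ ∀ K ∈ Ks, ∃ L ∈ Ls, K ⊓ L = ⊥

/-! ### Regular languages as inputs of algorithms -/

/-- A finite description of a nondeterministic finite automaton whose states are natural numbers:
the list of its transitions `(p, a, q)`, its initial states and its accepting states. -/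
abbrev AutomatonCode (A : Type*) : Type _ := List (ℕ × A × ℕ) × List ℕ × List ℕ

namespace AutomatonCode

/-- The described automaton. Only the finitely many states listed in the code matter. -/
def toNFA {A : Type*} (c : AutomatonCode A) : NFA A ℕ where
  step p a := {q | (p, a, q) ∈ c.1}
  start := {q | q ∈ c.2.1}
  accept := {q | q ∈ c.2.2}

/-- The regular language given by a code. -/
def language {A : Type*} (c : AutomatonCode A) : Language A := c.toNFA.accepts

/-- Over a finite alphabet, the languages given by codes are exactly the regular languages. -/
theorem isRegular_iff_exists {A : Type*} [Finite A] (L : Language A) :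
    L.IsRegular ↔ ∃ c : AutomatonCode A, c.language = L := by
  classical
  constructor
  · rintro ⟨σ, _, M, rfl⟩
    have := Fintype.ofFinite A
    let e := Fintype.equivFin σ
    let f : σ → ℕ := fun s => (e s : ℕ)
    have hf : Function.Injective f := fun s t h => e.injective (Fin.ext h)
    let c : AutomatonCode A :=
      ((Finset.univ : Finset (σ × A)).toList.map fun x => (f x.1, x.2, f (M.step x.1 x.2)),
        [f M.start], (Finset.univ.filter (· ∈ M.accept)).toList.map f)
    have hstep : ∀ s a, c.toNFA.stepSet {f s} a = {f (M.step s a)} := by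
      intro s a
      ext q
      simp only [NFA.mem_stepSet, Set.mem_singleton_iff, exists_eq_left]
      simp only [toNFA, c, List.mem_map, Finset.mem_toList, Finset.mem_univ, true_and,
        Set.mem_ofPred_eq, Prod.mk.injEq, Prod.exists]
      constructor
      · rintro ⟨t, b, h, rfl, rfl⟩
        rw [hf h]
      · rintro rfl
        exact ⟨s, a, rfl, rfl, rfl⟩
    have hev : ∀ (w : List A) (s : σ), c.toNFA.evalFrom {f s} w = {f (M.evalFrom s w)} := by
      intro w
      induction w with
      | nil => intro s; rfl
      | cons a w ih => intro s; rw [NFA.evalFrom_cons, hstep, ih]; rfl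
    have hstart : c.toNFA.start = {f M.start} := by
      ext q; simp [toNFA, c]
    refine ⟨c, ?_⟩
    ext w
    rw [language, NFA.mem_accepts, hstart, hev, DFA.mem_accepts]
    simp only [Set.mem_singleton_iff, exists_eq_right]
    simp only [toNFA, c, List.mem_map, Finset.mem_toList, Finset.mem_filter, Finset.mem_univ,
      true_and, Set.mem_ofPred_eq]
    constructor
    · rintro ⟨t, ht, h⟩
      rw [hf h] at ht
      exact ht
    · intro h
      exact ⟨_, h, rfl⟩
  · rintro ⟨c, rfl⟩
    let F : Finset ℕ := (c.2.1 ++ c.1.map fun x => x.2.2).toFinset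
    have hsub : ∀ x : List A, c.toNFA.eval x ⊆ F := by
      intro x
      induction x using List.reverseRecOn with
      | nil =>
        intro q hq
        have hq' : q ∈ c.2.1 := hq
        simp [F, hq']
      | append_singleton x a _ =>
        intro q hq
        rw [NFA.eval_append_singleton, NFA.mem_stepSet] at hq
        obtain ⟨p, -, hp⟩ := hq
        have hp' : (p, a, q) ∈ c.1 := hp
        simp only [F, List.coe_toFinset, List.mem_append, List.mem_map, Set.mem_ofPred_eq]
        exact Or.inr ⟨_, hp', rfl⟩
    refine Language.IsRegular.of_finite_range_leftQuotient ?_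
    refine (F.finite_toSet.finite_subsets.image fun S => c.toNFA.acceptsFrom S).subset ?_
    rintro _ ⟨x, rfl⟩
    refine ⟨c.toNFA.eval x, hsub x, ?_⟩
    ext y
    rw [Language.mem_leftQuotient, language, NFA.accepts_eq_acceptsFrom_start,
      NFA.append_mem_acceptsFrom]
    rfl

end AutomatonCode

/-! ### The decision problems

`ComputablePred` is algorithmic decidability (total recursive characteristic function). -/

/-- `D`-membership is decidable: input one regular language. -/
def MembershipDecidable {A : Type*} [Primcodable A] (D : Set (Language A)) : Prop :=
  ComputablePred fun c : AutomatonCode A => c.language ∈ D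

/-- `D`-separation is decidable: input two regular languages. -/
def SeparationDecidable {A : Type*} [Primcodable A] (D : Set (Language A)) : Prop :=
  ComputablePred fun p : AutomatonCode A × AutomatonCode A =>
    IsClassSeparable D p.1.language p.2.language

/-- `D`-covering is decidable: input a regular language and a finite set of regular languages. -/
def CoveringDecidable {A : Type*} [Primcodable A] (D : Set (Language A)) : Prop :=
  ComputablePred fun p : AutomatonCode A × List (AutomatonCode A) =>
    IsCoverable D p.1.language {L | ∃ c ∈ p.2, c.language = L}

/-! When it is nonempty, the star-free closure of a finite quotient-closed `C` is also the closure
of the languages recognized by one morphism `f` into a finite monoid `N`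
(`exists_starFreeClosure_eq_productClass`); for the star-free languages, `N` is trivial. Give each
letter the pair of its image in `N` and its family of transition relations in the input automata.
These pairs and the unit generate a finite set, closed under products and under replacing `(e, r)`,
`e` idempotent, by `(e, r ^ E ⊔ r ^ (E + 1))`. A pair is harmless if in some automaton its relation
joins no initial state to an accepting one. Coverability holds exactly when every pair of this
saturation is harmless (`isCoverable_iff_forall_saturation`).

Necessity: finitely many languages of the closure are saturated by one congruence for which `u ^ k`
and `u ^ (k + 1)` are congruent for large `k` whenever the value of `u` in `N` is idempotent. Hence
each pair of the saturation is realized inside a single congruence class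
(`Saturation.exists_isRealizedAt`), and a pair that is not harmless yields a class meeting all the
input languages, so no cover can separate them.

Sufficiency: `hasBoundedPartition` splits all words into finitely many star-free classes, each
bounded by one pair of the saturation or by the unit; the classes meeting the first language form
the cover. The partition comes from an induction in the style of local divisors. If right
multiplication by some letter `c` misses part of the saturation, words are cut after each `c`:
blocks have a smaller alphabet, and words of blocks have a strictly smaller saturation. Otherwise
`E`-th powers act trivially on the right of values of long words, and a prefix together with the
value in `N` determines a bound.

The saturation is finite and reached by boundedly many rounds, so covering is decidable. Separation
is covering with one language on the right; membership is separation from the complement, computed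
by the subset construction. -/

/-! ### Saturated sets of values -/

section Saturation

variable {N R : Type*} [SemilatticeSup R]

/-- Equal first components and comparable second components. -/
def IsBelow (x y : N × R) : Prop := x.1 = y.1 ∧ x.2 ≤ y.2

theorem IsBelow.refl (x : N × R) : IsBelow x x := ⟨rfl, le_rfl⟩

theorem IsBelow.trans {x y z : N × R} (h : IsBelow x y) (h' : IsBelow y z) : IsBelow x z :=
  ⟨h.1.trans h'.1, h.2.trans h'.2⟩

variable [Monoid N] [Monoid R]

/-- Replace the second component by the join of its `E`-th and `(E + 1)`-st powers. -/
def powerMerge (E : ℕ) (x : N × R) : N × R := (x.1, x.2 ^ E ⊔ x.2 ^ (E + 1))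

/-- The least set containing `G`, closed under multiplication, and closed under merging of powers of
the pairs with idempotent first component. -/
inductive Saturation (E : ℕ) (G : Set (N × R)) : N × R → Prop
  | basic (x : N × R) : x ∈ G → Saturation E G x
  | mul (x y : N × R) : Saturation E G x → Saturation E G y → Saturation E G (x * y)
  | merge (x : N × R) : Saturation E G x → IsIdempotentElem x.1 →
      Saturation E G (powerMerge E x)

theorem IsBelow.mul [MulLeftMono R] [MulRightMono R] {x y x' y' : N × R} (h : IsBelow x y)
    (h' : IsBelow x' y') : IsBelow (x * x') (y * y') :=
  ⟨congrArg₂ _ h.1 h'.1, mul_le_mul' h.2 h'.2⟩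

theorem Saturation.le {E : ℕ} {G H : Set (N × R)} (h : ∀ x ∈ G, Saturation E H x) {x : N × R}
    (hx : Saturation E G x) : Saturation E H x := by
  induction hx with
  | basic x hx => exact h x hx
  | mul x y _ _ ihx ihy => exact ihx.mul _ _ ihy
  | merge x _ hi ih => exact ih.merge _ hi

theorem Saturation.pow {E : ℕ} {G : Set (N × R)} {x : N × R} (hx : Saturation E G x) {k : ℕ}
    (hk : 0 < k) : Saturation E G (x ^ k) := by
  induction k, hk using Nat.le_induction with
  | base => simpa using hx
  | succ k _ ih => rw [pow_succ]; exact ih.mul _ _ hx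

theorem Saturation.list_prod {α : Type*} {E : ℕ} {v : α → N × R} {w : List α} (hw : w ≠ []) :
    Saturation E (Set.range v) (w.map v).prod := by
  induction w with
  | nil => exact absurd rfl hw
  | cons a w ih =>
    rw [List.map_cons, List.prod_cons]
    have ha : Saturation E (Set.range v) (v a) := .basic _ ⟨a, rfl⟩
    rcases eq_or_ne w [] with rfl | h
    · simpa using ha
    · exact ha.mul _ _ (ih h)

theorem pow_mul_pow_of_idempotent {M : Type*} [Monoid M] {E : ℕ} {x : M}
    (hx : x ^ E * x ^ E = x ^ E) {k : ℕ} (hk : 0 < k) : x ^ (E * k) = x ^ E := by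
  rw [pow_mul]
  induction k, hk using Nat.le_induction with
  | base => simp
  | succ k _ ih => rw [pow_succ, ih, hx]

theorem isBelow_pow_powerMerge {E : ℕ} (hE : 0 < E) {y : N × R} (hy : IsIdempotentElem y.1) :
    IsBelow (y ^ E) (powerMerge E y) ∧ IsBelow (y ^ (E + 1)) (powerMerge E y) := by
  obtain ⟨k, rfl⟩ := Nat.exists_eq_succ_of_ne_zero hE.ne'
  exact ⟨⟨by simp [powerMerge, hy.pow_succ_eq], le_sup_left⟩,
    ⟨by simp [powerMerge, hy.pow_succ_eq], le_sup_right⟩⟩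

/-- If right multiplication by `E`-th powers fixes the values of the words with prefix `u`, then
all such values with a given first component have a common bound in the saturation. -/
theorem exists_saturation_bound [Finite N] [Finite R] [MulLeftMono R] [MulRightMono R] {α : Type*}
    {E : ℕ} (hE : 0 < E) (hid : ∀ x : N × R, x ^ E * x ^ E = x ^ E) (v : α → N × R) {u : List α}
    (hu : u ≠ [])
    (H : ∀ w z : List α, ((u ++ w).map v).prod * (z.map v).prod ^ E = ((u ++ w).map v).prod)
    (w₀ : List α) :
    ∃ s, Saturation E (Set.range v) s ∧
      ∀ w, ((u ++ w).map v).prod.1 = ((u ++ w₀).map v).prod.1 → IsBelow ((u ++ w).map v).prod s := by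
  set val : List α → N × R := fun w => (w.map v).prod with hval
  have hmul : ∀ w z, val (w ++ z) = val w * val z := fun w z => by simp [hval]
  have H' : ∀ w z, val (u ++ w) * val z ^ E = val (u ++ w) := H
  have hpow : ∀ (z : List α) (k : ℕ), ∃ z', val z' = val z ^ k := by
    intro z k
    induction k with
    | zero => exact ⟨[], by simp [hval]⟩
    | succ k ih =>
      obtain ⟨z', hz'⟩ := ih
      exact ⟨z' ++ z, by rw [hmul, hz', pow_succ]⟩
  set q := val (u ++ w₀) with hq
  have hqS : Saturation E (Set.range v) q := Saturation.list_prod (by simp [hu])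
  -- Moving `val u` across turns the power of `q` on its left into a power of `val (w₀ ++ u)` on its
  -- right, which `H'` absorbs.
  have hqE : ∀ w, q ^ E * val (u ++ w) = val (u ++ w) := by
    intro w
    have h1 : SemiconjBy (val u) (val (w₀ ++ u)) q := by
      simp only [SemiconjBy, hq, hmul, mul_assoc]
    have h2 := H' [] (w₀ ++ u)
    rw [List.append_nil] at h2
    rw [hmul, ← mul_assoc, ← (h1.pow_right E).eq, h2]
  let Z : Set (N × R) := {z | ∃ w, z = val (u ++ w) ∧ z.1 = q.1}
  have key : ∃ s, (Saturation E (Set.range v) s ∧ IsBelow q s) ∧ ∀ z ∈ Z, IsBelow z s := by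
    refine Set.Finite.induction_on_subset (motive := fun Z' _ => ∃ s, (Saturation E (Set.range v) s ∧
      IsBelow q s) ∧ ∀ z ∈ Z', IsBelow z s) Z (Set.toFinite Z) ⟨q, ⟨hqS, IsBelow.refl _⟩, by simp⟩ ?_
    rintro z Z' ⟨w, rfl, hz⟩ hZ' - ⟨s, ⟨hs, hqs⟩, hs'⟩
    obtain ⟨z', hz'⟩ := hpow (u ++ w₀) (E - 1)
    -- This `y` carries `q` to the new value, `q * y = val (u ++ w)`, while its first component is
    -- that of `q ^ E`, hence idempotent, so `y` may be merged.
    set y := q ^ (E - 1) * val (u ++ w) with hy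
    have hyv : y = val (z' ++ (u ++ w)) := by rw [hmul, hz']
    have hyS : Saturation E (Set.range v) y := by
      rw [hyv]; exact Saturation.list_prod (by simp [hu])
    have hqy : q * y = val (u ++ w) := by
      rw [hy, ← mul_assoc, ← pow_succ', Nat.sub_add_cancel hE, hqE]
    have hy1 : IsIdempotentElem y.1 := by
      have : y.1 = (q ^ E).1 := by
        rw [hy, Prod.fst_mul, hz, ← Prod.fst_mul, ← pow_succ, Nat.sub_add_cancel hE]
      rw [this]
      exact congrArg Prod.fst (hid q)
    obtain ⟨hm, hm'⟩ := isBelow_pow_powerMerge hE hy1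
    have hfix : ∀ w, val (u ++ w) * y ^ E = val (u ++ w) := fun w => by rw [hyv, H']
    -- The part `y ^ E` of the merge fixes `q` and all values bounded so far; the part `y ^ (E + 1)`
    -- sends `q` to the new value.
    refine ⟨s * powerMerge E y, ⟨hs.mul _ _ (hyS.merge _ hy1), ?_⟩, ?_⟩
    · have := hqs.mul hm
      rwa [hq, hfix] at this
    · rintro x (rfl | hx)
      · have := hqs.mul hm'
        rwa [pow_succ, ← mul_assoc, hq, hfix, ← hq, hqy] at this
      · have := (hs' x hx).mul hm
        obtain ⟨w', rfl, -⟩ := hZ' hx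
        rwa [hfix] at this
  obtain ⟨s, ⟨hs, -⟩, hs'⟩ := key
  exact ⟨s, hs, fun w hw => hs' _ ⟨w, rfl, hw⟩⟩

end Saturation

/-! ### Elementary star-free languages -/

section StarFree

variable {α : Type*}

/-- The languages determined by the product of the values of the letters. -/
def productClass {N : Type*} [Monoid N] (f : α → N) : Set (Language α) :=
  {L | ∃ F : Set N, L = ({w | (w.map f).prod ∈ F} : Language α)}

theorem InStarFreeClosure.mono {C D : Set (Language α)} (h : ∀ L ∈ C, InStarFreeClosure D L)
    {L : Language α} (hL : InStarFreeClosure C L) : InStarFreeClosure D L := by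
  induction hL with
  | basic L hL => exact h L hL
  | letter a => exact .letter a
  | union K L _ _ hK hL => exact .union _ _ hK hL
  | inter K L _ _ hK hL => exact .inter _ _ hK hL
  | compl L _ hL => exact .compl _ hL
  | concat K L _ _ hK hL => exact .concat _ _ hK hL

theorem InStarFreeClosure.congr {C : Set (Language α)} {K L : Language α}
    (hK : InStarFreeClosure C K) (h : ∀ w, w ∈ L ↔ w ∈ K) : InStarFreeClosure C L := by
  rwa [Language.ext h]

/-- Some member is required: for empty `C` over an empty alphabet the closure itself is empty. -/
theorem InStarFreeClosure.top_bot {C : Set (Language α)} {L : Language α}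
    (hL : InStarFreeClosure C L) :
    InStarFreeClosure C (⊤ : Language α) ∧ InStarFreeClosure C (⊥ : Language α) := by
  have h : InStarFreeClosure C (⊤ : Language α) :=
    (InStarFreeClosure.union _ _ hL (.compl _ hL)).congr fun w =>
      ⟨fun _ => em _, fun _ => trivial⟩
  exact ⟨h, (InStarFreeClosure.compl _ h).congr fun w => ⟨fun h => h.elim, fun h => h trivial⟩⟩

theorem InStarFreeClosure.finite_union {C : Set (Language α)} (hC : InStarFreeClosure C ⊤)
    {ι : Type*} [Finite ι] (p : ι → Prop) (L : ι → Language α)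
    (hL : ∀ i, p i → InStarFreeClosure C (L i)) :
    InStarFreeClosure C ({w | ∃ i, p i ∧ w ∈ L i} : Language α) := by
  have key : ∀ s : Set ι, InStarFreeClosure C ({w | ∃ i ∈ s, p i ∧ w ∈ L i} : Language α) := by
    intro s
    refine Set.Finite.induction_on s (Set.toFinite s) ?_ ?_
    · exact hC.top_bot.2.congr fun w => ⟨fun ⟨_, h, _⟩ => h.elim, fun h => h.elim⟩
    · intro a s _ _ ih
      by_cases ha : p a
      · refine (InStarFreeClosure.union _ _ (hL a ha) ih).congr fun w => ⟨?_, ?_⟩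
        · rintro ⟨i, rfl | hi, h⟩
          exacts [Or.inl h.2, Or.inr ⟨i, hi, h⟩]
        · rintro (h | ⟨i, hi, h⟩)
          exacts [⟨a, Or.inl rfl, ha, h⟩, ⟨i, Or.inr hi, h⟩]
      · refine ih.congr fun w => ⟨?_, ?_⟩
        · rintro ⟨i, rfl | hi, h⟩
          exacts [absurd h.1 ha, ⟨i, hi, h⟩]
        · rintro ⟨i, hi, h⟩
          exact ⟨i, Or.inr hi, h⟩
  exact (key Set.univ).congr fun w =>
    ⟨fun ⟨i, h⟩ => ⟨i, trivial, h⟩, fun ⟨i, _, h⟩ => ⟨i, h⟩⟩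

theorem InStarFreeClosure.nil [Finite α] {C : Set (Language α)} (hC : InStarFreeClosure C ⊤) :
    InStarFreeClosure C {[]} := by
  refine (InStarFreeClosure.compl _ (hC.finite_union (fun _ => True)
    (fun a : α => ({[a]} : Language α) * ⊤) fun a _ => .concat _ _ (.letter a) hC)).congr
    fun w => ⟨?_, ?_⟩
  · rintro rfl ⟨a, -, x, rfl, y, -, h⟩
    simp at h
  · intro h
    cases w with
    | nil => rfl
    | cons a w => exact (h ⟨a, trivial, [a], rfl, w, trivial, rfl⟩).elim

theorem InStarFreeClosure.word [Finite α] {C : Set (Language α)} (hC : InStarFreeClosure C ⊤)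
    (w : List α) : InStarFreeClosure C {w} := by
  induction w with
  | nil => exact .nil hC
  | cons a w ih =>
    refine (InStarFreeClosure.concat _ _ (.letter a) ih).congr fun x => ⟨?_, ?_⟩
    · rintro rfl
      exact ⟨[a], rfl, w, rfl, rfl⟩
    · rintro ⟨_, rfl, _, rfl, rfl⟩
      rfl

theorem InStarFreeClosure.productClass_top {N : Type*} [Monoid N] (f : α → N) :
    InStarFreeClosure (productClass f) ⊤ :=
  .basic _ ⟨Set.univ, Language.ext fun _ => ⟨fun _ => trivial, fun _ => trivial⟩⟩

theorem InStarFreeClosure.product_eq {N : Type*} [Monoid N] (f : α → N) (t : N) :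
    InStarFreeClosure (productClass f) ({w | (w.map f).prod = t} : Language α) :=
  .basic _ ⟨{t}, rfl⟩

theorem InStarFreeClosure.take_eq [Finite α] {C : Set (Language α)} (hC : InStarFreeClosure C ⊤)
    (n : ℕ) (u : List α) : InStarFreeClosure C ({w | w.take n = u} : Language α) := by
  rcases lt_trichotomy u.length n with h | h | h
  · refine (InStarFreeClosure.word hC u).congr fun w => ⟨fun hw => ?_, ?_⟩
    · have hw' : w.take n = u := hw
      have hl := congrArg List.length hw'
      rw [List.length_take] at hl
      rw [List.take_of_length_le (by omega)] at hw'
      exact hw'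
    · rintro rfl
      exact List.take_of_length_le h.le
  · refine (InStarFreeClosure.concat _ _ (.word hC u) hC).congr fun w => ⟨fun hw => ?_, ?_⟩
    · exact ⟨u, rfl, w.drop n, trivial, by rw [← show w.take n = u from hw]; simp⟩
    · rintro ⟨_, rfl, y, -, rfl⟩
      exact List.take_left' h
  · refine hC.top_bot.2.congr fun w => ⟨fun hw => ?_, fun h => h.elim⟩
    have hl := congrArg List.length (show w.take n = u from hw)
    rw [List.length_take] at hl
    omega

/-- Inclusion of a smaller alphabet. -/
theorem InStarFreeClosure.map_subtype [Finite α] {N : Type*} [Monoid N] (f : α → N) (c : α)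
    {L : Language {a // a ≠ c}}
    (hL : InStarFreeClosure (productClass fun a : {a // a ≠ c} => f a) L) :
    InStarFreeClosure (productClass f)
      ({w | ∃ u ∈ L, u.map Subtype.val = w} : Language α) := by
  have htop := InStarFreeClosure.productClass_top f
  have hinj : Function.Injective (List.map (Subtype.val : {a // a ≠ c} → α)) :=
    List.map_injective_iff.2 Subtype.val_injective
  -- Words avoiding `c` are the complement of `A* c A*`. Complements over the smaller alphabet must
  -- be intersected with this set.
  have hrange : InStarFreeClosure (productClass f)
      ({w | ∃ u : List {a // a ≠ c}, u.map Subtype.val = w} : Language α) := by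
    refine (InStarFreeClosure.compl _ (.concat _ _ htop (.concat _ _ (.letter c) htop))).congr
      fun w => ⟨?_, fun hw => ?_⟩
    · rintro ⟨u, rfl⟩ ⟨x, -, _, ⟨_, rfl, y, -, rfl⟩, h⟩
      have hc : c ∈ u.map Subtype.val := by rw [← h]; simp
      obtain ⟨a, -, ha⟩ := List.mem_map.1 hc
      exact a.2 ha
    · have hc : ∀ a ∈ w, a ≠ c := by
        rintro a ha rfl
        obtain ⟨x, y, rfl⟩ := List.append_of_mem ha
        exact hw ⟨x, trivial, _, ⟨[a], rfl, y, trivial, rfl⟩, rfl⟩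
      exact ⟨w.attach.map fun a => ⟨a.1, hc a.1 a.2⟩, by simp⟩
  induction hL with
  | basic L hL =>
    obtain ⟨F, rfl⟩ := hL
    refine (InStarFreeClosure.inter _ _ hrange (.basic _ ⟨F, rfl⟩)).congr fun w => ⟨?_, ?_⟩
    · rintro ⟨u, hu, rfl⟩
      have hu' : (u.map fun a : {a // a ≠ c} => f a).prod ∈ F := hu
      exact ⟨⟨u, rfl⟩, by
        change ((u.map Subtype.val).map f).prod ∈ F
        rwa [List.map_map]⟩
    · rintro ⟨⟨u, rfl⟩, hu⟩
      have hu' : ((u.map Subtype.val).map f).prod ∈ F := hu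
      rw [List.map_map] at hu'
      exact ⟨u, hu', rfl⟩
  | letter a =>
    refine (InStarFreeClosure.letter a.1).congr fun w => ⟨?_, ?_⟩
    · rintro ⟨_, rfl, rfl⟩; rfl
    · rintro rfl; exact ⟨[a], rfl, rfl⟩
  | union K L _ _ hK hL =>
    refine (InStarFreeClosure.union _ _ hK hL).congr fun w => ⟨?_, ?_⟩
    · rintro ⟨u, hu | hu, rfl⟩
      exacts [Or.inl ⟨u, hu, rfl⟩, Or.inr ⟨u, hu, rfl⟩]
    · rintro (⟨u, hu, rfl⟩ | ⟨u, hu, rfl⟩)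
      exacts [⟨u, Or.inl hu, rfl⟩, ⟨u, Or.inr hu, rfl⟩]
  | inter K L _ _ hK hL =>
    refine (InStarFreeClosure.inter _ _ hK hL).congr fun w => ⟨?_, ?_⟩
    · rintro ⟨u, hu, rfl⟩
      exact ⟨⟨u, hu.1, rfl⟩, ⟨u, hu.2, rfl⟩⟩
    · rintro ⟨⟨u, hu, rfl⟩, ⟨u', hu', h⟩⟩
      obtain rfl := hinj h
      exact ⟨u', ⟨hu, hu'⟩, rfl⟩
  | compl L _ hL =>
    refine (InStarFreeClosure.inter _ _ hrange (.compl _ hL)).congr fun w => ⟨?_, ?_⟩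
    · rintro ⟨u, hu, rfl⟩
      refine ⟨⟨u, rfl⟩, ?_⟩
      rintro ⟨u', hu', h⟩
      obtain rfl := hinj h
      exact hu hu'
    · rintro ⟨⟨u, rfl⟩, hu⟩
      exact ⟨u, fun h => hu ⟨u, h, rfl⟩, rfl⟩
  | concat K L _ _ hK hL =>
    refine (InStarFreeClosure.concat _ _ hK hL).congr fun w => ⟨?_, ?_⟩
    · rintro ⟨_, ⟨x, hx, y, hy, rfl⟩, rfl⟩
      exact ⟨_, ⟨x, hx, rfl⟩, _, ⟨y, hy, rfl⟩, by simp⟩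
    · rintro ⟨_, ⟨x, hx, rfl⟩, _, ⟨y, hy, rfl⟩, rfl⟩
      exact ⟨x ++ y, ⟨x, hx, y, hy, rfl⟩, by simp⟩

end StarFree

/-! ### Cutting words after each occurrence of a letter -/

section Blocks

variable {α : Type*} {c : α}

/-- Append the letter `c` to each block and concatenate. -/
def joinBlocks (c : α) (bs : List (List {a // a ≠ c})) : List α :=
  bs.flatMap fun b => b.map Subtype.val ++ [c]

theorem joinBlocks_append (bs bs' : List (List {a // a ≠ c})) :
    joinBlocks c (bs ++ bs') = joinBlocks c bs ++ joinBlocks c bs' := List.flatMap_append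

theorem joinBlocks_cons (b : List {a // a ≠ c}) (bs : List (List {a // a ≠ c})) :
    joinBlocks c (b :: bs) = b.map Subtype.val ++ c :: joinBlocks c bs := by
  simp [joinBlocks]

open Classical in
/-- Cut a word after each occurrence of `c`; the second component is the rest after the last one. -/
noncomputable def cutBlocks (c : α) : List α → List (List {a // a ≠ c}) × List {a // a ≠ c}
  | [] => ([], [])
  | a :: w =>
    if h : a = c then ([] :: (cutBlocks c w).1, (cutBlocks c w).2)
    else match (cutBlocks c w).1 with
      | [] => ([], ⟨a, h⟩ :: (cutBlocks c w).2)
      | b :: bs => ((⟨a, h⟩ :: b) :: bs, (cutBlocks c w).2)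

theorem joinBlocks_cutBlocks (w : List α) :
    joinBlocks c (cutBlocks c w).1 ++ (cutBlocks c w).2.map Subtype.val = w := by
  induction w with
  | nil => rfl
  | cons a w ih =>
    rw [cutBlocks]
    split_ifs with h
    · subst h
      simpa [joinBlocks_cons] using ih
    · split
      · rename_i heq
        rw [heq] at ih
        simpa [joinBlocks] using ih
      · rename_i heq
        rw [heq, joinBlocks_cons] at ih
        simpa [joinBlocks_cons] using ih

theorem cutBlocks_map_val (r : List {a // a ≠ c}) :
    cutBlocks c (r.map Subtype.val) = ([], r) := by
  induction r with
  | nil => rfl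
  | cons a r ih => rw [List.map_cons, cutBlocks, dif_neg a.2, ih]

theorem cutBlocks_block (b : List {a // a ≠ c}) (w : List α) :
    cutBlocks c (b.map Subtype.val ++ c :: w) = (b :: (cutBlocks c w).1, (cutBlocks c w).2) := by
  induction b with
  | nil => rw [List.map_nil, List.nil_append, cutBlocks, dif_pos rfl]
  | cons a b ih => rw [List.map_cons, List.cons_append, cutBlocks, dif_neg a.2, ih]

theorem cutBlocks_joinBlocks (bs : List (List {a // a ≠ c})) (r : List {a // a ≠ c}) :
    cutBlocks c (joinBlocks c bs ++ r.map Subtype.val) = (bs, r) := by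
  induction bs with
  | nil => exact cutBlocks_map_val r
  | cons b bs ih => rw [joinBlocks_cons, List.append_assoc, List.cons_append, cutBlocks_block, ih]

/-- Unique cutting makes the image under `joinBlocks` commute with intersection and with complement
relative to the range. -/
theorem joinBlocks_injective : Function.Injective (joinBlocks c) := by
  intro bs bs' h
  have h1 := cutBlocks_joinBlocks bs []
  have h2 := cutBlocks_joinBlocks bs' []
  rw [h, h2] at h1
  exact (congrArg Prod.fst h1).symm

theorem exists_joinBlocks_iff (w : List α) :
    (∃ bs, joinBlocks c bs = w) ↔ w = [] ∨ ∃ w', w' ++ [c] = w := by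
  constructor
  · rintro ⟨bs, rfl⟩
    induction bs using List.reverseRecOn with
    | nil => exact Or.inl rfl
    | append_singleton bs b _ =>
      exact Or.inr ⟨joinBlocks c bs ++ b.map Subtype.val, by
        simp [joinBlocks]⟩
  · rintro (rfl | ⟨w', rfl⟩)
    · exact ⟨[], rfl⟩
    · refine ⟨(cutBlocks c w').1 ++ [(cutBlocks c w').2], ?_⟩
      conv_rhs => rw [← joinBlocks_cutBlocks (c := c) w']
      simp [joinBlocks]

/-- Substituting classes of blocks for letters preserves star-freeness. -/
theorem InStarFreeClosure.joinBlocks [Finite α] {N : Type*} [Monoid N] (f : α → N) {β : Type*}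
    (κ : List {a // a ≠ c} → β) (g : β → N)
    (hg : ∀ u, g (κ u) = (u.map fun a : {a // a ≠ c} => f a).prod * f c)
    (hκ : ∀ b, InStarFreeClosure (productClass fun a : {a // a ≠ c} => f a)
      ({u | κ u = b} : Language {a // a ≠ c}))
    {V : Language β} (hV : InStarFreeClosure (productClass g) V) :
    InStarFreeClosure (productClass f)
      ({w | ∃ bs, bs.map κ ∈ V ∧ _root_.joinBlocks c bs = w} : Language α) := by
  have htop := InStarFreeClosure.productClass_top f
  have hrange : InStarFreeClosure (productClass f)
      ({w | ∃ bs, _root_.joinBlocks c bs = w} : Language α) := by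
    refine (InStarFreeClosure.union _ _ (.nil htop) (.concat _ _ htop (.letter c))).congr
      fun w => (exists_joinBlocks_iff w).trans ⟨?_, ?_⟩
    · rintro (rfl | ⟨w', rfl⟩)
      exacts [Or.inl rfl, Or.inr ⟨w', trivial, [c], rfl, rfl⟩]
    · rintro (h | ⟨w', -, _, rfl, rfl⟩)
      exacts [Or.inl h, Or.inr ⟨w', rfl⟩]
  -- By `hg` a class of blocks has the value of the block followed by `c`, so a product condition on
  -- the word of classes is a product condition on the joined word.
  have hprod : ∀ bs : List (List {a // a ≠ c}),
      ((bs.map κ).map g).prod = ((_root_.joinBlocks c bs).map f).prod := by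
    intro bs
    induction bs with
    | nil => rfl
    | cons b bs ih =>
      rw [List.map_cons, List.map_cons, List.prod_cons, ih, hg, joinBlocks_cons]
      simp [mul_assoc]
  induction hV with
  | basic L hL =>
    obtain ⟨F, rfl⟩ := hL
    refine (InStarFreeClosure.inter _ _ hrange (.basic _ ⟨F, rfl⟩)).congr fun w => ⟨?_, ?_⟩
    · rintro ⟨bs, h, rfl⟩
      refine ⟨⟨bs, rfl⟩, ?_⟩
      change ((_root_.joinBlocks c bs).map f).prod ∈ F
      rw [← hprod]
      exact h
    · rintro ⟨⟨bs, rfl⟩, h⟩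
      have h' : ((_root_.joinBlocks c bs).map f).prod ∈ F := h
      rw [← hprod] at h'
      exact ⟨bs, h', rfl⟩
  | letter b =>
    refine (InStarFreeClosure.concat _ _ ((hκ b).map_subtype f c) (.letter c)).congr
      fun w => ⟨?_, ?_⟩
    · rintro ⟨bs, h, rfl⟩
      obtain ⟨u, rfl, hu⟩ := List.map_eq_singleton_iff.1 (show bs.map κ = [b] from h)
      exact ⟨u.map Subtype.val, ⟨u, hu, rfl⟩, [c], rfl, by simp [_root_.joinBlocks]⟩
    · rintro ⟨_, ⟨u, hu, rfl⟩, _, rfl, rfl⟩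
      refine ⟨[u], ?_, by simp [_root_.joinBlocks]⟩
      rw [List.map_singleton, show κ u = b from hu]
      rfl
  | union K L _ _ hK hL =>
    refine (InStarFreeClosure.union _ _ hK hL).congr fun w => ⟨?_, ?_⟩
    · rintro ⟨u, hu | hu, rfl⟩
      exacts [Or.inl ⟨u, hu, rfl⟩, Or.inr ⟨u, hu, rfl⟩]
    · rintro (⟨u, hu, rfl⟩ | ⟨u, hu, rfl⟩)
      exacts [⟨u, Or.inl hu, rfl⟩, ⟨u, Or.inr hu, rfl⟩]
  | inter K L _ _ hK hL =>
    refine (InStarFreeClosure.inter _ _ hK hL).congr fun w => ⟨?_, ?_⟩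
    · rintro ⟨u, hu, rfl⟩
      exact ⟨⟨u, hu.1, rfl⟩, ⟨u, hu.2, rfl⟩⟩
    · rintro ⟨⟨u, hu, rfl⟩, ⟨u', hu', h⟩⟩
      obtain rfl := joinBlocks_injective h
      exact ⟨u', ⟨hu, hu'⟩, rfl⟩
  | compl L _ hL =>
    refine (InStarFreeClosure.inter _ _ hrange (.compl _ hL)).congr fun w => ⟨?_, ?_⟩
    · rintro ⟨u, hu, rfl⟩
      refine ⟨⟨u, rfl⟩, ?_⟩
      rintro ⟨u', hu', h⟩
      obtain rfl := joinBlocks_injective h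
      exact hu hu'
    · rintro ⟨⟨u, rfl⟩, hu⟩
      exact ⟨u, fun h => hu ⟨u, h, rfl⟩, rfl⟩
  | concat K L _ _ hK hL =>
    refine (InStarFreeClosure.concat _ _ hK hL).congr fun w => ⟨?_, ?_⟩
    · rintro ⟨bs, ⟨x, hx, y, hy, h⟩, rfl⟩
      obtain ⟨bs₁, bs₂, rfl, rfl, rfl⟩ := List.map_eq_append_iff.1 h.symm
      exact ⟨_, ⟨bs₁, hx, rfl⟩, _, ⟨bs₂, hy, rfl⟩, (joinBlocks_append _ _).symm⟩
    · rintro ⟨_, ⟨x, hx, rfl⟩, _, ⟨y, hy, rfl⟩, rfl⟩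
      exact ⟨x ++ y, ⟨_, hx, _, hy, by simp⟩, joinBlocks_append _ _⟩

end Blocks

/-! ### Star-free partitions bounded by the saturation -/

section Partition

theorem fst_list_prod {N R α : Type*} [Monoid N] [Monoid R] (v : α → N × R) (w : List α) :
    (w.map fun a => (v a).1).prod = (w.map v).prod.1 := by
  induction w with
  | nil => rfl
  | cons a w ih => simp [ih]

variable {N R : Type*} [SemilatticeSup R] [Monoid N] [Monoid R]

/-- There is a finite partition of the words into star-free classes such that the values of the
words of each class have a common bound in the saturation. -/
def HasBoundedPartition {α : Type*} (E : ℕ) (v : α → N × R) : Prop :=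
  ∃ (m : ℕ) (κ : List α → Fin m) (s : Fin m → N × R),
    (∀ i, s i = 1 ∨ Saturation E (Set.range v) (s i)) ∧
    (∀ w, IsBelow (w.map v).prod (s (κ w))) ∧
    ∀ i, InStarFreeClosure (productClass fun a => (v a).1) ({w | κ w = i} : Language α)

theorem HasBoundedPartition.of_finite {α : Type*} {E : ℕ} {v : α → N × R} {ι : Type*} [Finite ι]
    (κ : List α → ι)
    (h : ∀ i, ∃ s, (s = 1 ∨ Saturation E (Set.range v) s) ∧
      ∀ w, κ w = i → IsBelow (w.map v).prod s)
    (hκ : ∀ i, InStarFreeClosure (productClass fun a => (v a).1) ({w | κ w = i} : Language α)) :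
    HasBoundedPartition E v := by
  obtain ⟨m, ⟨e⟩⟩ := Finite.exists_equiv_fin ι
  choose s hs hs' using h
  refine ⟨m, fun w => e (κ w), fun i => s (e.symm i), fun i => hs _, fun w => hs' _ _ (by simp),
    fun i => (hκ (e.symm i)).congr fun w => ?_⟩
  exact e.eq_symm_apply.symm

/-- The partition by prefixes of length `E` and first components of values. -/
theorem HasBoundedPartition.of_prefix [MulLeftMono R] [MulRightMono R] [Finite N] [Finite R]
    {α : Type*} [Finite α] {E : ℕ}
    (hE : 0 < E) (hid : ∀ x : N × R, x ^ E * x ^ E = x ^ E) (v : α → N × R)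
    (H : ∀ u : List α, u.length = E → ∀ w z : List α,
      ((u ++ w).map v).prod * (z.map v).prod ^ E = ((u ++ w).map v).prod) :
    HasBoundedPartition E v := by
  have : Finite {u : List α // u.length ≤ E} := (List.finite_length_le α E).to_subtype
  have htop := InStarFreeClosure.productClass_top fun a => (v a).1
  refine .of_finite (ι := {u : List α // u.length ≤ E} × N)
    (fun w => (⟨w.take E, by simp⟩, (w.map v).prod.1)) ?_ ?_
  · rintro ⟨⟨u, hu⟩, t⟩
    by_cases hne : ∃ w₀ : List α, w₀.take E = u ∧ (w₀.map v).prod.1 = t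
    · obtain ⟨w₀, hw₀, ht⟩ := hne
      -- A prefix shorter than `E` is the whole word, so its class has at most one element and needs
      -- no merging.
      rcases hu.lt_or_eq with hu | hu
      · refine ⟨(u.map v).prod, ?_, ?_⟩
        · rcases eq_or_ne u [] with rfl | h
          exacts [Or.inl rfl, Or.inr (Saturation.list_prod h)]
        · intro w hw
          have hw' : w.take E = u := congrArg (fun x => x.1.1) hw
          have hl := congrArg List.length hw'
          rw [List.length_take] at hl
          rw [List.take_of_length_le (by omega)] at hw'
          rw [hw']
          exact IsBelow.refl _
      · have hu0 : u ≠ [] := by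
          rintro rfl
          exact hE.ne hu
        obtain ⟨s, hs, hs'⟩ := exists_saturation_bound hE hid v hu0 (H u hu) (w₀.drop E)
        refine ⟨s, Or.inr hs, fun w hw => ?_⟩
        have hw' : w.take E = u := congrArg (fun x => x.1.1) hw
        have hwt : (w.map v).prod.1 = t := congrArg (fun x => x.2) hw
        have h1 : u ++ w.drop E = w := by rw [← hw', List.take_append_drop]
        have h2 : u ++ w₀.drop E = w₀ := by rw [← hw₀, List.take_append_drop]
        have := hs' (w.drop E)
        rw [h1, h2] at this
        exact this (hwt.trans ht.symm)
    · exact ⟨1, Or.inl rfl, fun w hw => absurd ⟨w, congrArg (fun x => x.1.1) hw,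
        congrArg (fun x => x.2) hw⟩ hne⟩
  · rintro ⟨⟨u, hu⟩, t⟩
    refine (InStarFreeClosure.inter _ _ (.take_eq htop E u)
      (InStarFreeClosure.product_eq _ t)).congr fun w => ⟨fun h => ?_, fun h => ?_⟩
    · obtain ⟨h1, h2⟩ := Prod.ext_iff.1 h
      exact ⟨congrArg Subtype.val h1, (fst_list_prod v w).trans h2⟩
    · exact Prod.ext (Subtype.ext h.1) ((fst_list_prod v w).symm.trans h.2)

/-- If right multiplication by no letter shrinks the saturation, then the values of long words are
fixed by right multiplication with `E`-th powers. -/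
theorem prod_mul_pow_eq_of_forall_mem {α : Type*} {E : ℕ} (hE : 0 < E)
    (hid : ∀ x : N × R, x ^ E * x ^ E = x ^ E) (v : α → N × R)
    (h : ∀ c, ∀ s, Saturation E (Set.range v) s →
      ∃ s', (s' = 1 ∨ Saturation E (Set.range v) s') ∧ s' * v c = s)
    {u : List α} (hu : u.length = E) (w z : List α) :
    ((u ++ w).map v).prod * (z.map v).prod ^ E = ((u ++ w).map v).prod := by
  have hu0 : u ≠ [] := by
    rintro rfl
    exact hE.ne hu
  -- In the first case the adjoined unit in `h` can be avoided, so right multiplication by any word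
  -- maps the saturation onto itself. Any element is then a multiple of an idempotent `E`-th power
  -- and is fixed by it.
  by_cases hc : ∀ c, ∃ s', Saturation E (Set.range v) s' ∧ s' * v c = v c
  · have hsurj : ∀ z : List α, ∀ s, Saturation E (Set.range v) s →
        ∃ s', Saturation E (Set.range v) s' ∧ s' * (z.map v).prod = s := by
      intro z
      induction z using List.reverseRecOn with
      | nil => exact fun s hs => ⟨s, hs, by simp⟩
      | append_singleton z c ih =>
        intro s hs
        obtain ⟨s', hs', rfl⟩ := h c s hs
        have : ∃ s'', Saturation E (Set.range v) s'' ∧ s'' * v c = s' * v c := by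
          rcases hs' with rfl | hs'
          · obtain ⟨s'', h1, h2⟩ := hc c
            exact ⟨s'', h1, by rw [h2, one_mul]⟩
          · exact ⟨s', hs', rfl⟩
        obtain ⟨s'', h1, h2⟩ := this
        obtain ⟨s₃, h3, rfl⟩ := ih s'' h1
        exact ⟨s₃, h3, by rw [← h2]; simp [mul_assoc]⟩
    have hpow : ∀ k : ℕ, ∀ s, Saturation E (Set.range v) s →
        ∃ s', Saturation E (Set.range v) s' ∧ s' * (z.map v).prod ^ k = s := by
      intro k
      induction k with
      | zero => exact fun s hs => ⟨s, hs, by simp⟩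
      | succ k ih =>
        intro s hs
        obtain ⟨s', hs', rfl⟩ := hsurj z s hs
        obtain ⟨s'', hs'', rfl⟩ := ih s' hs'
        exact ⟨s'', hs'', by rw [pow_succ, mul_assoc]⟩
    obtain ⟨s', -, hs'⟩ := hpow E _
      (Saturation.list_prod (E := E) (v := v) (w := u ++ w) (by simp [hu0]))
    rw [← hs', mul_assoc, hid]
  · push Not at hc
    obtain ⟨c, hc⟩ := hc
    -- Each of `v c`, `v d` is a left multiple of the other. Were both factors non-units of the
    -- saturation, their product would fix `v c`, against `hc`. So all letters share one value, and
    -- word values depend on length alone.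
    have hval : ∀ d, v d = v c := by
      intro d
      obtain ⟨s, hs, hsd⟩ := h d (v c) (.basic _ ⟨c, rfl⟩)
      obtain ⟨s', hs', hsc⟩ := h c (v d) (.basic _ ⟨d, rfl⟩)
      rcases hs with rfl | hs
      · rw [← hsd, one_mul]
      · rcases hs' with rfl | hs'
        · rw [← hsc, one_mul]
        · exact absurd (by rw [mul_assoc, hsc, hsd]) (hc (s * s') (hs.mul _ _ hs'))
    have hprod : ∀ w : List α, (w.map v).prod = v c ^ w.length := by
      intro w
      induction w with
      | nil => simp
      | cons a w ih => rw [List.map_cons, List.prod_cons, ih, hval a, List.length_cons, pow_succ']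
    rw [hprod, hprod, ← pow_mul, mul_comm z.length, pow_mul, List.length_append, hu, add_comm E,
      pow_add, mul_assoc]
    congr 1
    induction z.length with
    | zero => simp
    | succ k ih => rw [pow_succ, ← mul_assoc, ih, hid]

/-- The saturation of a set of left multiples of `y` by elements of a saturation consists of such
multiples. -/
theorem Saturation.exists_mul_of_forall_mem (hsup : ∀ a b c : R, (a ⊔ b) * c = a * c ⊔ b * c)
    {E : ℕ} (hE : 0 < E) (hid : ∀ x : N × R, x ^ E * x ^ E = x ^ E) {G H : Set (N × R)} {y : N × R}
    (hy : Saturation E G y)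
    (h : ∀ x ∈ H, ∃ s, (s = 1 ∨ Saturation E G s) ∧ s * y = x) {x : N × R}
    (hx : Saturation E H x) : ∃ s, (s = 1 ∨ Saturation E G s) ∧ s * y = x := by
  have hmul : ∀ s, (s = 1 ∨ Saturation E G s) → Saturation E G (s * y) := by
    rintro s (rfl | hs)
    exacts [by rwa [one_mul], hs.mul _ _ hy]
  induction hx with
  | basic x hx => exact h x hx
  | mul x x' _ _ ih ih' =>
    obtain ⟨s, hs, rfl⟩ := ih
    obtain ⟨s', hs', rfl⟩ := ih'
    refine ⟨s * y * s', Or.inr ?_, by simp only [mul_assoc]⟩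
    rcases hs' with rfl | hs'
    exacts [by rw [mul_one]; exact hmul s hs, (hmul s hs).mul _ _ hs']
  | merge x _ hi ih =>
    obtain ⟨s, hs, rfl⟩ := ih
    set x := s * y with hx
    have hxS : Saturation E G x := hmul s hs
    -- The merge absorbs `x ^ E` on the right, so it ends with a factor `x = s * y` and is again a
    -- left multiple of `y`.
    have h1 : powerMerge E x * x ^ E = powerMerge E x := by
      have hE2 := congrArg Prod.snd (hid x)
      simp only [Prod.snd_mul, Prod.pow_snd] at hE2
      refine Prod.ext ?_ ?_
      · obtain ⟨k, rfl⟩ := Nat.exists_eq_succ_of_ne_zero hE.ne'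
        simp only [Prod.fst_mul, Prod.pow_fst, powerMerge]
        rw [hi.pow_succ_eq, hi]
      · simp only [Prod.snd_mul, Prod.pow_snd, powerMerge]
        rw [hsup, hE2, pow_succ', mul_assoc, hE2]
    have hm : Saturation E G (powerMerge E x * x ^ (E - 1)) := by
      rcases Nat.eq_zero_or_pos (E - 1) with h0 | h0
      · rw [h0, pow_zero, mul_one]
        exact hxS.merge _ hi
      · exact (hxS.merge _ hi).mul _ _ (hxS.pow h0)
    refine ⟨powerMerge E x * x ^ (E - 1) * s, Or.inr ?_, ?_⟩
    · rcases hs with rfl | hs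
      exacts [by rwa [mul_one], hm.mul _ _ hs]
    · rw [mul_assoc, ← hx, mul_assoc, ← pow_succ, Nat.sub_add_cancel hE, h1]

/-- Combine a partition of the words without the letter `c` and a partition of the words whose
letters are classes of blocks. -/
theorem HasBoundedPartition.of_blocks [MulLeftMono R] [MulRightMono R] {α : Type*} [Finite α]
    {E : ℕ} (v : α → N × R) (c : α)
    {β : Type*} [Finite β] (κ : List {a // a ≠ c} → β) (s : β → N × R)
    (hs : ∀ i, s i = 1 ∨ Saturation E (Set.range v) (s i))
    (hb : ∀ u, IsBelow (u.map fun a : {a // a ≠ c} => v a).prod (s (κ u)))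
    (hκ : ∀ i, InStarFreeClosure (productClass fun a : {a // a ≠ c} => (v a).1)
      ({u | κ u = i} : Language {a // a ≠ c}))
    (h : HasBoundedPartition E fun i => s i * v c) : HasBoundedPartition E v := by
  obtain ⟨m, κ', s', hs', hb', hκ'⟩ := h
  have hsv : ∀ i, Saturation E (Set.range v) (s i * v c) := by
    intro i
    have hc : Saturation E (Set.range v) (v c) := .basic _ ⟨c, rfl⟩
    rcases hs i with h | h
    exacts [by rwa [h, one_mul], h.mul _ _ hc]
  have hjoin : ∀ bs : List (List {a // a ≠ c}),
      IsBelow ((joinBlocks c bs).map v).prod ((bs.map κ).map fun i => s i * v c).prod := by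
    intro bs
    induction bs with
    | nil => exact IsBelow.refl _
    | cons b bs ih =>
      have := ((hb b).mul (IsBelow.refl (v c))).mul ih
      simpa [joinBlocks_cons, mul_assoc, Function.comp_def] using this
  refine .of_finite (ι := Fin m × β)
    (fun w => (κ' ((cutBlocks c w).1.map κ), κ (cutBlocks c w).2)) ?_ ?_
  · rintro ⟨i, j⟩
    -- The bound for the joined blocks times the bound for the remainder without `c`.
    refine ⟨s' i * s j, ?_, ?_⟩
    · have h1 : s' i = 1 ∨ Saturation E (Set.range v) (s' i) :=
        (hs' i).imp_right fun h => h.le (by rintro _ ⟨j, rfl⟩; exact hsv j)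
      rcases h1 with h1 | h1
      · rw [h1, one_mul]; exact hs j
      · rcases hs j with h2 | h2
        exacts [Or.inr (by rwa [h2, mul_one]), Or.inr (h1.mul _ _ h2)]
    · intro w hw
      obtain ⟨rfl, rfl⟩ := Prod.ext_iff.1 hw
      have h1 := ((hjoin (cutBlocks c w).1).trans (hb' _)).mul (hb (cutBlocks c w).2)
      have h2 : (w.map v).prod = ((joinBlocks c (cutBlocks c w).1).map v).prod *
          ((cutBlocks c w).2.map fun a : {a // a ≠ c} => v a).prod := by
        conv_lhs => rw [← joinBlocks_cutBlocks (c := c) w]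
        simp
      rw [h2]
      exact h1
  · rintro ⟨i, j⟩
    refine (InStarFreeClosure.concat _ _
      (InStarFreeClosure.joinBlocks (fun a => (v a).1) κ (fun i => (s i * v c).1) (fun u => ?_) hκ
        (hκ' i)) ((hκ j).map_subtype _ _)).congr fun w => ⟨fun hw => ?_, ?_⟩
    · rw [fst_list_prod (fun a : {a // a ≠ c} => v a), (hb u).1, Prod.fst_mul]
    · obtain ⟨h1, h2⟩ := Prod.ext_iff.1 hw
      exact ⟨_, ⟨(cutBlocks c w).1, h1, rfl⟩, _, ⟨(cutBlocks c w).2, h2, rfl⟩,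
        joinBlocks_cutBlocks w⟩
    · rintro ⟨_, ⟨bs, h1, rfl⟩, _, ⟨r, h2, rfl⟩, rfl⟩
      change (κ' _, κ _) = _
      rw [cutBlocks_joinBlocks]
      exact Prod.ext h1 h2

/-- Lexicographic induction: first on the size of the saturation, then on that of the alphabet.
Deleting `c` shrinks the alphabet without enlarging the saturation; passing to blocks may enlarge
the alphabet but strictly shrinks the saturation. -/
theorem hasBoundedPartition_aux [MulLeftMono R] [MulRightMono R] [Finite N] [Finite R]
    (hsup : ∀ a b c : R, (a ⊔ b) * c = a * c ⊔ b * c)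
    {E : ℕ} (hE : 0 < E) (hid : ∀ x : N × R, x ^ E * x ^ E = x ^ E) (n : ℕ) :
    ∀ (k : ℕ) (α : Type*) [Finite α] (v : α → N × R),
      {x | Saturation E (Set.range v) x}.ncard = n → Nat.card α = k →
      HasBoundedPartition E v := by
  induction n using Nat.strong_induction_on with
  | _ n ihn =>
  intro k
  induction k using Nat.strong_induction_on with
  | _ k ihk =>
  intro α _ v hn hk
  by_cases hA : ∀ c, ∀ s, Saturation E (Set.range v) s →
      ∃ s', (s' = 1 ∨ Saturation E (Set.range v) s') ∧ s' * v c = s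
  · exact .of_prefix hE hid v fun u hu w z => prod_mul_pow_eq_of_forall_mem hE hid v hA hu w z
  push Not at hA
  obtain ⟨c, x, hx, hx'⟩ := hA
  have hsub : ∀ y, Saturation E (Set.range fun a : {a // a ≠ c} => v a) y →
      Saturation E (Set.range v) y :=
    fun y hy => hy.le (by rintro _ ⟨a, rfl⟩; exact .basic _ ⟨a, rfl⟩)
  have hrest : HasBoundedPartition E fun a : {a // a ≠ c} => v a := by
    have hcard : Nat.card {a // a ≠ c} < k := hk ▸ Finite.card_subtype_lt (x := c) (by simp)
    rcases (Set.ncard_le_ncard hsub (Set.toFinite _)).lt_or_eq with h | h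
    · exact ihn _ (hn ▸ h) _ _ _ rfl rfl
    · exact ihk _ hcard _ _ (h.trans hn) rfl
  obtain ⟨m, κ, s, hs, hb, hκ⟩ := hrest
  have hs1 : ∀ i, s i = 1 ∨ Saturation E (Set.range v) (s i) := fun i => (hs i).imp_right (hsub _)
  -- The new alphabet is lifted because the induction hypothesis ranges over alphabets in one fixed
  -- universe.
  refine .of_blocks v c (β := ULift (Fin m)) (fun u => ⟨κ u⟩) (fun i => s i.down)
    (fun i => hs1 _) hb (fun i => (hκ i.down).congr fun w => ?_) ?_
  · exact ⟨fun h => congrArg ULift.down h, fun h => ULift.ext _ _ h⟩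
  · refine ihn _ ?_ _ _ _ rfl rfl
    rw [← hn]
    refine Set.ncard_lt_ncard ?_ (Set.toFinite _)
    have hc : Saturation E (Set.range v) (v c) := .basic _ ⟨c, rfl⟩
    have hmem : ∀ y, Saturation E (Set.range fun i : ULift (Fin m) => s i.down * v c) y →
        ∃ s', (s' = 1 ∨ Saturation E (Set.range v) s') ∧ s' * v c = y := fun y hy =>
      Saturation.exists_mul_of_forall_mem hsup hE hid hc
        (by rintro _ ⟨i, rfl⟩; exact ⟨_, hs1 _, rfl⟩) hy
    refine Set.ssubset_iff_subset_ne.2 ⟨fun y hy => ?_, fun h => ?_⟩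
    · obtain ⟨s', hs', rfl⟩ := hmem y hy
      rcases hs' with rfl | hs'
      exacts [by simpa using hc, hs'.mul _ _ hc]
    · obtain ⟨s', hs', h'⟩ := hmem x (h.symm ▸ hx : x ∈ {x | _})
      exact hx' s' hs' h'

theorem hasBoundedPartition [MulLeftMono R] [MulRightMono R] [Finite N] [Finite R]
    (hsup : ∀ a b c : R, (a ⊔ b) * c = a * c ⊔ b * c)
    {E : ℕ} (hE : 0 < E) (hid : ∀ x : N × R, x ^ E * x ^ E = x ^ E) {α : Type*} [Finite α]
    (v : α → N × R) : HasBoundedPartition E v :=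
  hasBoundedPartition_aux hsup hE hid _ _ α v rfl rfl

end Partition

/-! ### Families of binary relations -/

/-- Families of binary relations on `Q` indexed by `I`, multiplied by composition. -/
def RelFamily (I Q : Type*) : Type _ := I → Q → Q → Prop

namespace RelFamily

variable {I Q : Type*}

instance : SemilatticeSup (RelFamily I Q) := inferInstanceAs (SemilatticeSup (I → Q → Q → Prop))

instance [Finite I] [Finite Q] : Finite (RelFamily I Q) :=
  inferInstanceAs (Finite (I → Q → Q → Prop))

instance : Monoid (RelFamily I Q) where
  mul r s := fun i p q => ∃ m, r i p m ∧ s i m q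
  one := fun _ p q => p = q
  mul_assoc r s t := by
    funext i p q
    refine propext ⟨?_, ?_⟩
    · rintro ⟨m, ⟨m', h1, h2⟩, h3⟩
      exact ⟨m', h1, m, h2, h3⟩
    · rintro ⟨m, h1, m', h2, h3⟩
      exact ⟨m', ⟨m, h1, h2⟩, h3⟩
  one_mul r := by
    funext i p q
    exact propext ⟨fun ⟨_, h, h'⟩ => by rwa [show p = _ from h], fun h => ⟨p, rfl, h⟩⟩
  mul_one r := by
    funext i p q
    exact propext ⟨fun ⟨_, h, h'⟩ => by rwa [← show _ = q from h'], fun h => ⟨q, h, rfl⟩⟩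

instance : MulLeftMono (RelFamily I Q) :=
  ⟨fun _ _ _ h i _ q ⟨m, h1, h2⟩ => ⟨m, h1, h i m q h2⟩⟩

instance : MulRightMono (RelFamily I Q) :=
  ⟨fun _ _ _ h i p _ ⟨m, h1, h2⟩ => ⟨m, h i p m h1, h2⟩⟩

theorem sup_mul (r s t : RelFamily I Q) : (r ⊔ s) * t = r * t ⊔ s * t := by
  funext i p q
  refine propext ⟨?_, ?_⟩
  · rintro ⟨m, h1 | h1, h2⟩
    exacts [Or.inl ⟨m, h1, h2⟩, Or.inr ⟨m, h1, h2⟩]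
  · rintro (⟨m, h1, h2⟩ | ⟨m, h1, h2⟩)
    exacts [⟨m, Or.inl h1, h2⟩, ⟨m, Or.inr h1, h2⟩]

end RelFamily

/-! ### Congruences stable under powers -/

section PowerStable

variable {α N : Type*} [Monoid N]

/-- The `k`-th power of a word. -/
def wordPow (u : List α) (k : ℕ) : List α := (List.replicate k u).flatten

theorem wordPow_zero (u : List α) : wordPow u 0 = [] := rfl

theorem wordPow_succ (u : List α) (k : ℕ) : wordPow u (k + 1) = u ++ wordPow u k := rfl

theorem wordPow_one (u : List α) : wordPow u 1 = u := by simp [wordPow]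

theorem wordPow_add (u : List α) (i j : ℕ) : wordPow u (i + j) = wordPow u i ++ wordPow u j := by
  rw [wordPow, ← List.replicate_append_replicate, List.flatten_append]
  rfl

theorem prod_map_wordPow (f : α → N) (u : List α) (k : ℕ) :
    ((wordPow u k).map f).prod = (u.map f).prod ^ k := by
  induction k with
  | zero => simp [wordPow]
  | succ k ih => rw [wordPow_succ, List.map_append, List.prod_append, ih, pow_succ']

/-- A cut splits one copy of `u`, leaving `k` whole copies shared between the two sides. -/
theorem append_eq_wordPow_succ {u x y : List α} {k : ℕ} (h : x ++ y = wordPow u (k + 1)) :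
    ∃ i j p s, i + j = k ∧ p ++ s = u ∧ x = wordPow u i ++ p ∧ y = s ++ wordPow u j := by
  induction k generalizing x with
  | zero => exact ⟨0, 0, x, y, rfl, by simpa [wordPow] using h, by simp [wordPow], by simp [wordPow]⟩
  | succ k ih =>
    rw [wordPow_succ, List.append_eq_append_iff] at h
    rcases h with ⟨s, rfl, rfl⟩ | ⟨x', rfl, h⟩
    · exact ⟨0, k + 1, x, s, by omega, rfl, by simp [wordPow], rfl⟩
    · obtain ⟨i, j, p, s, rfl, rfl, rfl, rfl⟩ := ih h.symm
      exact ⟨i + 1, j, p, s, by omega, rfl, by simp [wordPow_succ], rfl⟩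

/-- A congruence on words such that large powers of every word with idempotent value are all
congruent. -/
structure IsPowerStable (f : α → N) (r : List α → List α → Prop) : Prop where
  equiv : Equivalence r
  append : ∀ {u u' v v'}, r u u' → r v v' → r (u ++ v) (u' ++ v')
  stable : ∀ u : List α, IsIdempotentElem (u.map f).prod →
    ∃ k, r (wordPow u k) (wordPow u (k + 1))

theorem IsPowerStable.stable_of_le {f : α → N} {r : List α → List α → Prop}
    (hr : IsPowerStable f r) {u : List α} {k : ℕ} (h : r (wordPow u k) (wordPow u (k + 1))) {n : ℕ}
    (hn : k ≤ n) : r (wordPow u n) (wordPow u (n + 1)) := by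
  induction n, hn using Nat.le_induction with
  | base => exact h
  | succ n _ ih =>
    rw [wordPow_succ, wordPow_succ u (n + 1)]
    exact hr.append (hr.equiv.refl u) ih

theorem IsPowerStable.inter {f : α → N} {r s : List α → List α → Prop} (hr : IsPowerStable f r)
    (hs : IsPowerStable f s) : IsPowerStable f fun u v => r u v ∧ s u v where
  equiv := ⟨fun u => ⟨hr.equiv.refl u, hs.equiv.refl u⟩,
    fun h => ⟨hr.equiv.symm h.1, hs.equiv.symm h.2⟩,
    fun h h' => ⟨hr.equiv.trans h.1 h'.1, hs.equiv.trans h.2 h'.2⟩⟩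
  append h h' := ⟨hr.append h.1 h'.1, hs.append h.2 h'.2⟩
  stable u hu := by
    obtain ⟨k, hk⟩ := hr.stable u hu
    obtain ⟨l, hl⟩ := hs.stable u hu
    exact ⟨k + l, hr.stable_of_le hk (by omega), hs.stable_of_le hl (by omega)⟩

theorem isPowerStable_prod (f : α → N) :
    IsPowerStable f fun u v => (u.map f).prod = (v.map f).prod where
  equiv := ⟨fun _ => rfl, fun h => h.symm, fun h h' => h.trans h'⟩
  append h h' := by simp only [List.map_append, List.prod_append, h, h']
  stable u hu := ⟨1, by rw [prod_map_wordPow, prod_map_wordPow, pow_one, pow_two, hu]⟩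

/-- This congruence isolates words of length at most one, as the singletons of letters require. -/
theorem isPowerStable_length (f : α → N) :
    IsPowerStable f fun u v => u = v ∨ 2 ≤ u.length ∧ 2 ≤ v.length where
  equiv := by
    refine ⟨fun _ => Or.inl rfl, fun h => h.imp Eq.symm And.symm, ?_⟩
    rintro x y z (rfl | h) (rfl | h')
    exacts [Or.inl rfl, Or.inr h', Or.inr h, Or.inr ⟨h.1, h'.2⟩]
  append := by
    rintro u u' v v' (rfl | h) (rfl | h')
    · exact Or.inl rfl
    all_goals
      right
      simp only [List.length_append]
      omega
  stable u _ := by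
    rcases eq_or_ne u [] with rfl | hu
    · exact ⟨0, Or.inl (by simp [wordPow])⟩
    · have := List.length_pos_iff.2 hu
      refine ⟨2, Or.inr ?_⟩
      simp only [wordPow_succ, wordPow_zero, List.length_append]
      omega

/-- The congruence by which the cuts of two words have the same types. -/
def cutCongruence (r s : List α → List α → Prop) (u v : List α) : Prop :=
  (r u v ∧ s u v) ∧
  (∀ x y, x ++ y = u → ∃ x' y', x' ++ y' = v ∧ r x x' ∧ s y y') ∧
  ∀ x y, x ++ y = v → ∃ x' y', x' ++ y' = u ∧ r x' x ∧ s y' y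

/-- This is the step for concatenation: membership in `K * L` depends only on the types of the cuts.
-/
theorem IsPowerStable.cutCongruence {f : α → N} {r s : List α → List α → Prop}
    (hr : IsPowerStable f r) (hs : IsPowerStable f s) :
    IsPowerStable f (cutCongruence r s) where
  equiv := by
    refine ⟨fun u => ⟨(hr.inter hs).equiv.refl u,
      fun x y h => ⟨x, y, h, hr.equiv.refl x, hs.equiv.refl y⟩,
      fun x y h => ⟨x, y, h, hr.equiv.refl x, hs.equiv.refl y⟩⟩, ?_, ?_⟩
    · rintro u v ⟨h, h1, h2⟩
      refine ⟨(hr.inter hs).equiv.symm h, fun x y hxy => ?_, fun x y hxy => ?_⟩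
      · obtain ⟨x', y', h3, h4, h5⟩ := h2 x y hxy
        exact ⟨x', y', h3, hr.equiv.symm h4, hs.equiv.symm h5⟩
      · obtain ⟨x', y', h3, h4, h5⟩ := h1 x y hxy
        exact ⟨x', y', h3, hr.equiv.symm h4, hs.equiv.symm h5⟩
    · rintro u v w ⟨h, h1, h2⟩ ⟨h', h1', h2'⟩
      refine ⟨(hr.inter hs).equiv.trans h h', fun x y hxy => ?_, fun x y hxy => ?_⟩
      · obtain ⟨x', y', h3, h4, h5⟩ := h1 x y hxy
        obtain ⟨x'', y'', h6, h7, h8⟩ := h1' x' y' h3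
        exact ⟨x'', y'', h6, hr.equiv.trans h4 h7, hs.equiv.trans h5 h8⟩
      · obtain ⟨x', y', h3, h4, h5⟩ := h2' x y hxy
        obtain ⟨x'', y'', h6, h7, h8⟩ := h2 x' y' h3
        exact ⟨x'', y'', h6, hr.equiv.trans h7 h4, hs.equiv.trans h8 h5⟩
  append := by
    rintro u u' v v' ⟨hu, hu1, hu2⟩ ⟨hv, hv1, hv2⟩
    refine ⟨(hr.inter hs).append hu hv, fun x y hxy => ?_, fun x y hxy => ?_⟩
    · rcases List.append_eq_append_iff.1 hxy with ⟨z, h1, rfl⟩ | ⟨z, rfl, h1⟩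
      · obtain ⟨x', z', rfl, hx, hz⟩ := hu1 x z h1.symm
        exact ⟨x', z' ++ v', by simp, hx, hs.append hz hv.2⟩
      · obtain ⟨z', y', rfl, hz, hy⟩ := hv1 z y h1.symm
        exact ⟨u' ++ z', y', by simp, hr.append hu.1 hz, hy⟩
    · rcases List.append_eq_append_iff.1 hxy with ⟨z, h1, rfl⟩ | ⟨z, rfl, h1⟩
      · obtain ⟨x', z', rfl, hx, hz⟩ := hu2 x z h1.symm
        exact ⟨x', z' ++ v, by simp, hx, hs.append hz hv.2⟩
      · obtain ⟨z', y', rfl, hz, hy⟩ := hv2 z y h1.symm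
        exact ⟨u ++ z', y', by simp, hr.append hu.1 hz, hy⟩
  stable u hu := by
    obtain ⟨k, hk⟩ := hr.stable u hu
    obtain ⟨l, hl⟩ := hs.stable u hu
    have hr' : ∀ i, k ≤ i → ∀ p, r (wordPow u i ++ p) (wordPow u (i + 1) ++ p) := fun i hi p =>
      hr.append (hr.stable_of_le hk hi) (hr.equiv.refl p)
    have hs' : ∀ i, l ≤ i → ∀ p, s (p ++ wordPow u i) (p ++ wordPow u (i + 1)) := fun i hi p =>
      hs.append (hs.equiv.refl p) (hs.stable_of_le hl hi)
    have hglue : ∀ i j p q, p ++ q = u →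
        (wordPow u i ++ p) ++ (q ++ wordPow u j) = wordPow u (i + j + 1) := by
      rintro i j p q rfl
      rw [add_assoc, add_comm j, wordPow_add, wordPow_add _ 1, wordPow_one]
      simp
    -- A cut of this power leaves `k + l` whole copies of `u`, hence `k` on the left or `l` on the
    -- right; on that side a copy can be inserted, and conversely removed from the next power.
    refine ⟨k + l + 1, ⟨hr.stable_of_le hk (by omega), hs.stable_of_le hl (by omega)⟩,
      fun x y hxy => ?_, fun x y hxy => ?_⟩
    · obtain ⟨i, j, p, q, hij, hpq, rfl, rfl⟩ := append_eq_wordPow_succ hxy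
      by_cases hi : k ≤ i
      · refine ⟨wordPow u (i + 1) ++ p, q ++ wordPow u j, ?_, hr' i hi p, hs.equiv.refl _⟩
        rw [hglue _ _ _ _ hpq]; congr 1; omega
      · refine ⟨wordPow u i ++ p, q ++ wordPow u (j + 1), ?_, hr.equiv.refl _, hs' j (by omega) q⟩
        rw [hglue _ _ _ _ hpq]; congr 1; omega
    · obtain ⟨i, j, p, q, hij, hpq, rfl, rfl⟩ := append_eq_wordPow_succ hxy
      by_cases hi : k + 1 ≤ i
      · obtain ⟨i, rfl⟩ := Nat.exists_eq_succ_of_ne_zero (show i ≠ 0 by omega)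
        refine ⟨wordPow u i ++ p, q ++ wordPow u j, ?_, hr' i (by omega) p, hs.equiv.refl _⟩
        rw [hglue _ _ _ _ hpq]; congr 1; omega
      · obtain ⟨j, rfl⟩ := Nat.exists_eq_succ_of_ne_zero (show j ≠ 0 by omega)
        refine ⟨wordPow u i ++ p, q ++ wordPow u j, ?_, hr.equiv.refl _, hs' j (by omega) q⟩
        rw [hglue _ _ _ _ hpq]; congr 1

/-- Every language of the star-free closure is saturated by a power-stable congruence. -/
theorem InStarFreeClosure.exists_isPowerStable {f : α → N} {L : Language α}
    (hL : InStarFreeClosure (productClass f) L) :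
    ∃ r, IsPowerStable f r ∧ ∀ u v, r u v → u ∈ L → v ∈ L := by
  induction hL with
  | basic L hL =>
    obtain ⟨F, rfl⟩ := hL
    exact ⟨_, isPowerStable_prod f, fun u v h hu => by
      change (v.map f).prod ∈ F
      rw [← h]
      exact hu⟩
  | letter a =>
    refine ⟨_, isPowerStable_length f, ?_⟩
    rintro u v (rfl | h) hu
    · exact hu
    · obtain rfl : u = [a] := hu
      simp at h
  | union K L _ _ hK hL =>
    obtain ⟨r, hr, hr'⟩ := hK
    obtain ⟨s, hs, hs'⟩ := hL
    exact ⟨_, hr.inter hs, fun u v h => Or.imp (hr' u v h.1) (hs' u v h.2)⟩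
  | inter K L _ _ hK hL =>
    obtain ⟨r, hr, hr'⟩ := hK
    obtain ⟨s, hs, hs'⟩ := hL
    exact ⟨_, hr.inter hs, fun u v h => And.imp (hr' u v h.1) (hs' u v h.2)⟩
  | compl L _ hL =>
    obtain ⟨r, hr, hr'⟩ := hL
    exact ⟨r, hr, fun u v h hu hv => hu (hr' v u (hr.equiv.symm h) hv)⟩
  | concat K L _ _ hK hL =>
    obtain ⟨r, hr, hr'⟩ := hK
    obtain ⟨s, hs, hs'⟩ := hL
    refine ⟨_, hr.cutCongruence hs, ?_⟩
    rintro u v ⟨-, h, -⟩ ⟨x, hx, y, hy, hxy⟩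
    obtain ⟨x', y', rfl, h1, h2⟩ := h x y hxy
    exact ⟨x', hr' _ _ h1 hx, y', hs' _ _ h2 hy, rfl⟩

theorem exists_isPowerStable_of_finite {f : α → N} {Ks : Set (Language α)} (hfin : Ks.Finite)
    (hKs : ∀ K ∈ Ks, InStarFreeClosure (productClass f) K) :
    ∃ r, IsPowerStable f r ∧ ∀ K ∈ Ks, ∀ u v, r u v → u ∈ K → v ∈ K := by
  induction Ks, hfin using Set.Finite.induction_on with
  | empty => exact ⟨_, isPowerStable_prod f, by simp⟩
  | insert _ _ ih =>
    obtain ⟨r, hr, hr'⟩ := ih fun K hK => hKs K (Or.inr hK)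
    obtain ⟨s, hs, hs'⟩ := (hKs _ (Or.inl rfl)).exists_isPowerStable
    refine ⟨_, hr.inter hs, ?_⟩
    rintro K (rfl | hK) u v h
    exacts [hs' u v h.2, hr' K hK u v h.1]

end PowerStable

/-! ### Characterization of coverable pairs -/

section Coverable

variable {α N I Q : Type*} [Monoid N]

/-- All pairs in `x` are realized by words congruent to `u`. -/
def IsRealizedAt (g : α → RelFamily I Q) (r : List α → List α → Prop) (u : List α)
    (x : RelFamily I Q) : Prop :=
  ∀ i p q, x i p q → ∃ w, r w u ∧ (w.map g).prod i p q

theorem IsRealizedAt.mul {f : α → N} {g : α → RelFamily I Q} {r : List α → List α → Prop}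
    (hr : IsPowerStable f r) {u u' : List α} {x x' : RelFamily I Q} (h : IsRealizedAt g r u x)
    (h' : IsRealizedAt g r u' x') : IsRealizedAt g r (u ++ u') (x * x') := by
  rintro i p q ⟨m, h1, h2⟩
  obtain ⟨w, hw, hw'⟩ := h i p m h1
  obtain ⟨z, hz, hz'⟩ := h' i m q h2
  exact ⟨w ++ z, hr.append hw hz, by
    rw [List.map_append, List.prod_append]
    exact ⟨m, hw', hz'⟩⟩

theorem IsRealizedAt.nil {f : α → N} (g : α → RelFamily I Q) {r : List α → List α → Prop}
    (hr : IsPowerStable f r) : IsRealizedAt g r [] 1 :=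
  fun _ _ _ h => ⟨[], hr.equiv.refl _, h⟩

theorem IsRealizedAt.pow {f : α → N} {g : α → RelFamily I Q} {r : List α → List α → Prop}
    (hr : IsPowerStable f r) {u : List α} {x : RelFamily I Q} (h : IsRealizedAt g r u x) (k : ℕ) :
    IsRealizedAt g r (wordPow u k) (x ^ k) := by
  induction k with
  | zero => exact IsRealizedAt.nil g hr
  | succ k ih => rw [wordPow_succ, pow_succ']; exact h.mul hr ih

theorem Saturation.exists_isRealizedAt {E : ℕ} (hE : 0 < E)
    (hid : ∀ x : RelFamily I Q, x ^ E * x ^ E = x ^ E) {f : α → N} {g : α → RelFamily I Q}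
    {r : List α → List α → Prop} (hr : IsPowerStable f r) {x : N × RelFamily I Q}
    (hx : Saturation E (insert 1 (Set.range fun a => (f a, g a))) x) :
    ∃ u, (u.map f).prod = x.1 ∧ IsRealizedAt g r u x.2 := by
  induction hx with
  | basic x hx =>
    rcases hx with rfl | ⟨a, rfl⟩
    · exact ⟨[], rfl, IsRealizedAt.nil g hr⟩
    · exact ⟨[a], by simp, fun i p q h => ⟨[a], hr.equiv.refl _, by simpa using h⟩⟩
  | mul x y _ _ ihx ihy =>
    obtain ⟨u, hu, hu'⟩ := ihx
    obtain ⟨v, hv, hv'⟩ := ihy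
    exact ⟨u ++ v, by simp [hu, hv], hu'.mul hr hv'⟩
  | merge x _ hi ih =>
    obtain ⟨u, hu, hu'⟩ := ih
    -- The exponent `E * (k + 1)` is beyond the stability threshold and gives `x.2` the same power
    -- as `E`. The pairs of `x.2 ^ (E + 1)` are realized one power higher, which stability makes
    -- congruent.
    obtain ⟨k, hk⟩ := hr.stable u (hu ▸ hi)
    have h1 : x.2 ^ (E * (k + 1)) = x.2 ^ E :=
      pow_mul_pow_of_idempotent (hid x.2) (Nat.succ_pos k)
    have hle : k ≤ E * (k + 1) :=
      (Nat.le_succ k).trans (Nat.le_mul_of_pos_left _ hE)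
    refine ⟨wordPow u (E * (k + 1)), ?_, ?_⟩
    · obtain ⟨n, hn⟩ := Nat.exists_eq_succ_of_ne_zero (show E * (k + 1) ≠ 0 by positivity)
      rw [prod_map_wordPow, hu, hn, hi.pow_succ_eq]
      rfl
    · rintro i p q (h | h)
      · rw [← h1] at h
        exact hu'.pow hr _ i p q h
      · rw [pow_succ, ← h1, ← pow_succ] at h
        obtain ⟨w, hw, hw'⟩ := hu'.pow hr _ i p q h
        exact ⟨w, hr.equiv.trans hw (hr.equiv.symm (hr.stable_of_le hk hle)), hw'⟩

/-- The language of the `i`-th automaton with transitions `g`. -/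
def familyLanguage (g : α → RelFamily I Q) (st ac : I → Set Q) (i : I) : Language α :=
  {w | ∃ p ∈ st i, ∃ q ∈ ac i, (w.map g).prod i p q}

theorem isCoverable_iff_forall_saturation [Finite α] [Finite N] [Finite I] [Finite Q] {E : ℕ}
    (hE : 0 < E) (hid : ∀ x : N × RelFamily I Q, x ^ E * x ^ E = x ^ E) (f : α → N)
    (g : α → RelFamily I Q) (st ac : I → Set Q) (i₀ : I) (J : Set I) (hJ : ∀ i, i = i₀ ∨ i ∈ J) :
    IsCoverable (starFreeClosure (productClass f)) (familyLanguage g st ac i₀)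
      (familyLanguage g st ac '' J) ↔
    ∀ x, Saturation E (insert 1 (Set.range fun a => (f a, g a))) x →
      ∃ i, ∀ p ∈ st i, ∀ q ∈ ac i, ¬ x.2 i p q := by
  constructor
  · rintro ⟨Ks, hKs, hdisj⟩ x hx
    by_contra! hcon
    obtain ⟨r, hr, hr'⟩ := exists_isPowerStable_of_finite hKs.finite hKs.subset_class
    obtain ⟨u, -, hu⟩ := hx.exists_isRealizedAt hE (fun x => congrArg Prod.snd (hid (1, x))) hr
    have hmeet : ∀ i, ∃ w, r w u ∧ w ∈ familyLanguage g st ac i := by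
      intro i
      obtain ⟨p, hp, q, hq, h⟩ := hcon i
      obtain ⟨w, hw, hw'⟩ := hu i p q h
      exact ⟨w, hw, p, hp, q, hq, hw'⟩
    obtain ⟨w₀, hw₀, hw₀'⟩ := hmeet i₀
    -- Since `K` is saturated by `r`, it contains the whole class of `u`, which meets every language
    -- of the family.
    obtain ⟨K, hK, hwK⟩ : ∃ K ∈ Ks, w₀ ∈ K := Set.mem_sUnion.1 (hKs.le_union hw₀')
    obtain ⟨_, ⟨j, -, rfl⟩, hKL⟩ := hdisj K hK
    obtain ⟨w, hw, hw'⟩ := hmeet j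
    have : w ∈ K ⊓ familyLanguage g st ac j :=
      ⟨hr' K hK w₀ w (hr.equiv.trans hw₀ (hr.equiv.symm hw)) hwK, hw'⟩
    rw [hKL] at this
    exact this
  · intro hS
    obtain ⟨m, κ, s, hs, hb, hκ⟩ := hasBoundedPartition RelFamily.sup_mul hE hid
      fun a => (f a, g a)
    have hprod : ∀ w : List α, (w.map g).prod = (w.map fun a => (f a, g a)).prod.2 := by
      intro w
      induction w with
      | nil => rfl
      | cons a w ih => simp [ih]
    have hs' : ∀ i, Saturation E (insert 1 (Set.range fun a => (f a, g a))) (s i) := by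
      intro i
      rcases hs i with h | h
      · exact .basic _ (Or.inl h)
      · exact h.le fun x hx => .basic _ (Or.inr hx)
    refine ⟨{K | ∃ i, K = ({w | κ w = i} : Language α) ∧ ∃ w ∈ familyLanguage g st ac i₀, κ w = i},
      ⟨?_, ?_, ?_⟩, ?_⟩
    · refine (Set.finite_range fun i => ({w | κ w = i} : Language α)).subset ?_
      rintro _ ⟨i, rfl, -⟩
      exact ⟨i, rfl⟩
    · rintro _ ⟨i, rfl, -⟩
      exact hκ i
    · intro w hw
      exact Set.mem_sUnion.2 ⟨_, ⟨κ w, rfl, w, hw, rfl⟩, rfl⟩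
    · rintro _ ⟨_, rfl, w₀, ⟨p, hp, q, hq, h⟩, rfl⟩
      obtain ⟨j, hj⟩ := hS _ (hs' (κ w₀))
      -- The class contains `w₀`, accepted by automaton `i₀`, so the harmless index of its bound
      -- cannot be `i₀`.
      have hjJ : j ∈ J := by
        refine (hJ j).resolve_left ?_
        rintro rfl
        rw [hprod] at h
        exact hj p hp q hq ((hb w₀).2 _ p q h)
      refine ⟨_, ⟨j, hjJ, rfl⟩, ?_⟩
      refine Language.ext fun w => ⟨?_, fun h => h.elim⟩
      rintro ⟨hw, p', hp', q', hq', h'⟩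
      rw [hprod] at h'
      refine (hj p' hp' q' hq' ?_).elim
      rw [← show κ w = κ w₀ from hw]
      exact (hb w).2 _ p' q' h'

end Coverable

/-! ### Finite quotient-closed Boolean algebras as product classes -/

section QuotientClosed

variable {A : Type*}

theorem starFreeClosure_eq {C D : Set (Language A)} (h : ∀ L ∈ C, InStarFreeClosure D L)
    (h' : ∀ L ∈ D, InStarFreeClosure C L) : starFreeClosure C = starFreeClosure D :=
  Set.Subset.antisymm (fun _ hL => hL.mono h) fun _ hL => hL.mono h'

/-- Over the trivial monoid the basic languages are only the empty and the full one; finite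
languages are recovered from letters. -/
theorem starFreeLanguages_eq [Finite A] :
    starFreeLanguages A = starFreeClosure (productClass fun _ : A => (1 : Unit)) := by
  refine starFreeClosure_eq (fun L hL => ?_) ?_
  · have htop := InStarFreeClosure.productClass_top fun _ : A => (1 : Unit)
    have : Finite {w : List A // w ∈ L} := Set.Finite.to_subtype hL
    refine (htop.finite_union (fun _ : {w : List A // w ∈ L} => True) (fun w => {w.1})
      fun w _ => .word htop w.1).congr fun w => ⟨fun hw => ⟨⟨w, hw⟩, trivial, rfl⟩, ?_⟩
    rintro ⟨⟨_, hw⟩, -, rfl⟩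
    exact hw
  · have hbot : InStarFreeClosure {L : Language A | {w : List A | w ∈ L}.Finite} ⊥ :=
      .basic _ Set.finite_empty
    rintro L ⟨F, rfl⟩
    by_cases h : (1 : Unit) ∈ F
    · exact hbot.compl.top_bot.1.congr fun w => ⟨fun _ => trivial, fun _ => h⟩
    · exact hbot.congr fun w => ⟨fun hw => h hw, fun hw => hw.elim⟩

theorem exists_starFreeClosure_eq_productClass.{u} {A : Type u} {C : Set (Language A)} (hfin : C.Finite)
    (hC : IsQuotientClosed C) (hne : (starFreeClosure C).Nonempty) :
    ∃ (N : Type u) (_ : Monoid N) (_ : Finite N) (f : A → N),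
      starFreeClosure C = starFreeClosure (productClass f) := by
  have : Finite C := hfin.to_subtype
  -- Letters act on `C` by left quotients. The opposite monoid is needed since the quotient by `ab`
  -- is the quotient by `a` followed by that by `b`.
  have : Finite (Function.End C)ᵐᵒᵖ := Finite.of_equiv (C → C) MulOpposite.opEquiv
  let φ : A → (Function.End C)ᵐᵒᵖ := fun a =>
    MulOpposite.op fun L => ⟨{u | [a] ++ u ∈ L.1}, hC.left_mem L.1 L.2 [a]⟩
  have hφ : ∀ (w u : List A) (L : C), u ∈ ((w.map φ).prod.unop L).1 ↔ w ++ u ∈ L.1 := by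
    intro w
    induction w with
    | nil => exact fun u L => Iff.rfl
    | cons a w ih =>
      intro u L
      rw [List.map_cons, List.prod_cons, MulOpposite.unop_mul]
      exact (ih u ((φ a).unop L))
  refine ⟨(Function.End C)ᵐᵒᵖ, inferInstance, inferInstance, φ,
    starFreeClosure_eq (fun L hL => ?_) ?_⟩
  · refine InStarFreeClosure.congr (.basic _ ⟨{t | [] ∈ (t.unop ⟨L, hL⟩).1}, rfl⟩) fun w => ?_
    have := hφ w [] ⟨L, hL⟩
    rw [List.append_nil] at this
    exact this.symm
  · obtain ⟨L₀, hL₀⟩ := hne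
    have htop : InStarFreeClosure C ⊤ := (InStarFreeClosure.top_bot hL₀).1
    have hfiber : ∀ t, InStarFreeClosure C ({w | (w.map φ).prod = t} : Language A) := by
      intro t
      -- A word is outside the fiber of `t` iff some `L`, `u` show that `w ++ u ∈ L` and `u ∈ t(L)`
      -- disagree. For given `L`, such a `u` matters only through its right quotient `M ∈ C` and the
      -- truth value `b`, so finitely many obstructions suffice.
      have h1 := InStarFreeClosure.compl _ (htop.finite_union
        (fun x : C × C × Bool => ∃ u : List A, (∀ w, w ∈ x.2.1.1 ↔ w ++ u ∈ x.1.1) ∧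
          (u ∈ (t.unop x.1).1 ↔ x.2.2 = true))
        (fun x => if x.2.2 = true then x.2.1.1ᶜ else x.2.1.1) (by
          rintro ⟨L, M, b⟩ -
          cases b
          exacts [.basic _ M.2, .compl _ (.basic _ M.2)]))
      refine h1.congr fun w => ⟨?_, fun hw => ?_⟩
      · rintro rfl ⟨⟨L, M, b⟩, ⟨u, hM, hu⟩, h⟩
        rw [hφ] at hu
        cases b
        · have h' : w ∈ M.1 := h
          exact absurd (hu.1 ((hM w).1 h')) (by simp)
        · have h' : w ∉ M.1 := h
          exact h' ((hM w).2 (hu.2 rfl))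
      · refine MulOpposite.unop_injective (funext fun L => Subtype.ext
          (Language.ext fun u => (hφ w u L).trans ?_))
        let M : C := ⟨{w | w ++ u ∈ L.1}, hC.right_mem L.1 L.2 u⟩
        by_cases hu : u ∈ (t.unop L).1
        · refine iff_of_true ?_ hu
          by_contra hwu
          exact hw ⟨(L, M, true), ⟨u, fun _ => Iff.rfl, iff_of_true hu rfl⟩, hwu⟩
        · refine iff_of_false ?_ hu
          intro hwu
          exact hw ⟨(L, M, false), ⟨u, fun _ => Iff.rfl, iff_of_false hu (by simp)⟩, hwu⟩
    rintro L ⟨F, rfl⟩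
    refine (htop.finite_union (fun t => t ∈ F) (fun t => {w | (w.map φ).prod = t})
      fun t _ => hfiber t).congr fun w => ⟨?_, ?_⟩
    · exact fun hw => ⟨_, hw, rfl⟩
    · rintro ⟨_, ht, rfl⟩
      exact ht

end QuotientClosed

/-! ### Relations between the decision problems -/

section Problems

variable {A : Type*}

/-- The union of a cover is a separator; nonemptiness supplies the empty union. -/
theorem isClassSeparable_iff_isCoverable {C : Set (Language A)} (hne : (starFreeClosure C).Nonempty)
    (L₁ L₂ : Language A) : IsClassSeparable (starFreeClosure C) L₁ L₂ ↔
      IsCoverable (starFreeClosure C) L₁ {L₂} := by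
  constructor
  · rintro ⟨K, hK, h, h'⟩
    refine ⟨{K}, ⟨Set.finite_singleton K, by simpa using hK, ?_⟩, ?_⟩
    · exact fun w hw => Set.mem_sUnion.2 ⟨K, rfl, h hw⟩
    · rintro _ rfl
      exact ⟨L₂, rfl, (inf_comm _ _).trans h'⟩
  · rintro ⟨Ks, hKs, hdisj⟩
    obtain ⟨L₀, hL₀⟩ := hne
    have htop := (InStarFreeClosure.top_bot hL₀).1
    have : Finite Ks := hKs.finite.to_subtype
    refine ⟨{w | ∃ K : Ks, True ∧ w ∈ K.1}, htop.finite_union (fun _ : Ks => True) (fun K => K.1)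
      fun K _ => hKs.subset_class K.2, fun w hw => ?_, ?_⟩
    · obtain ⟨K, hK, hwK⟩ : ∃ K ∈ Ks, w ∈ K := Set.mem_sUnion.1 (hKs.le_union hw)
      exact ⟨⟨K, hK⟩, trivial, hwK⟩
    · refine Language.ext fun w => ⟨?_, fun h => h.elim⟩
      rintro ⟨hw, ⟨K, hK⟩, -, hwK⟩
      obtain ⟨L, hL, hKL⟩ := hdisj K hK
      rw [show L = L₂ from hL] at hKL
      have : w ∈ K ⊓ L₂ := ⟨hwK, hw⟩
      rw [hKL] at this
      exact this.elim

theorem mem_iff_isClassSeparable_compl (D : Set (Language A)) (L : Language A) :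
    L ∈ D ↔ IsClassSeparable D L Lᶜ := by
  refine ⟨fun h => ⟨L, h, le_rfl, ?_⟩, ?_⟩
  · exact Language.ext fun w => ⟨fun h => h.1 h.2, fun h => h.elim⟩
  · rintro ⟨K, hK, h, h'⟩
    have : K = L := by
      refine Language.ext fun w => ⟨fun hw => ?_, fun hw => h hw⟩
      by_contra hwL
      have : w ∈ Lᶜ ⊓ K := ⟨hwL, hw⟩
      rw [h'] at this
      exact this
    exact this ▸ hK

theorem isCoverable_empty_iff (L : Language A) (Ls : Set (Language A)) :
    IsCoverable ∅ L Ls ↔ L = ⊥ := by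
  constructor
  · rintro ⟨Ks, hKs, -⟩
    refine Language.ext fun w => ⟨fun hw => ?_, fun h => h.elim⟩
    obtain ⟨K, hK, -⟩ : ∃ K ∈ Ks, w ∈ K := Set.mem_sUnion.1 (hKs.le_union hw)
    exact (hKs.subset_class hK).elim
  · rintro rfl
    exact ⟨∅, ⟨Set.finite_empty, Set.empty_subset _, bot_le⟩, by simp⟩

theorem isCoverable_nil_iff (D : Set (Language A)) (L : Language A) :
    IsCoverable D L ∅ ↔ L = ⊥ := by
  constructor
  · rintro ⟨Ks, hKs, h⟩
    refine Language.ext fun w => ⟨fun hw => ?_, fun h => h.elim⟩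
    obtain ⟨K, hK, -⟩ : ∃ K ∈ Ks, w ∈ K := Set.mem_sUnion.1 (hKs.le_union hw)
    obtain ⟨_, h', -⟩ := h K hK
    exact h'.elim
  · rintro rfl
    exact ⟨∅, ⟨Set.finite_empty, Set.empty_subset _, bot_le⟩, by simp⟩

end Problems

/-! ### The saturation algorithm on lists -/

namespace AutomatonCode

variable {A : Type*}

/-- All states occurring in the codes. -/
def stateList (cs : List (AutomatonCode A)) : List ℕ :=
  cs.flatMap fun c => (c.1.map fun x => x.1) ++ ((c.1.map fun x => x.2.2) ++ (c.2.1 ++ c.2.2))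

/-- All triples of a code and two states. -/
def triples (cs : List (AutomatonCode A)) : List (AutomatonCode A × ℕ × ℕ) :=
  cs.flatMap fun c => (stateList cs).flatMap fun p => (stateList cs).map fun q => (c, p, q)

theorem mem_triples {cs : List (AutomatonCode A)} {c : AutomatonCode A} {p q : ℕ} :
    (c, p, q) ∈ triples cs ↔ c ∈ cs ∧ p ∈ stateList cs ∧ q ∈ stateList cs := by
  simp only [triples, List.mem_flatMap, List.mem_map, Prod.mk.injEq]
  constructor
  · rintro ⟨_, hc, _, hp, _, hq, rfl, rfl, rfl⟩
    exact ⟨hc, hp, hq⟩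
  · rintro ⟨hc, hp, hq⟩
    exact ⟨_, hc, _, hp, _, hq, rfl, rfl, rfl⟩

open Classical in
/-- The identity relations. -/
noncomputable def listOne (cs : List (AutomatonCode A)) : List (AutomatonCode A × ℕ × ℕ) :=
  (triples cs).filter fun x => x.2.1 = x.2.2

open Classical in
/-- The transition relations of a letter. -/
noncomputable def listLetter (cs : List (AutomatonCode A)) (a : A) :
    List (AutomatonCode A × ℕ × ℕ) :=
  (triples cs).filter fun x => (x.2.1, a, x.2.2) ∈ x.1.1

open Classical in
/-- The compositions of relations. -/
noncomputable def listMul (cs : List (AutomatonCode A)) (l l' : List (AutomatonCode A × ℕ × ℕ)) :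
    List (AutomatonCode A × ℕ × ℕ) :=
  (triples cs).filter fun x =>
    ∃ m ∈ stateList cs, (x.1, x.2.1, m) ∈ l ∧ (x.1, m, x.2.2) ∈ l'

/-- The powers of relations. -/
noncomputable def listPow (cs : List (AutomatonCode A)) (l : List (AutomatonCode A × ℕ × ℕ))
    (k : ℕ) : List (AutomatonCode A × ℕ × ℕ) :=
  (listMul cs l)^[k] (listOne cs)

variable {N : Type*} [Monoid N]

/-- The generators of the saturation. -/
noncomputable def listInit (f : A → N) (as : List A) (cs : List (AutomatonCode A)) :
    List (N × List (AutomatonCode A × ℕ × ℕ)) :=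
  (1, listOne cs) :: as.map fun a => (f a, listLetter cs a)

open Classical in
/-- One round of the saturation algorithm. -/
noncomputable def listStep (E : ℕ) (cs : List (AutomatonCode A))
    (X : List (N × List (AutomatonCode A × ℕ × ℕ))) :
    List (N × List (AutomatonCode A × ℕ × ℕ)) :=
  X ++ ((X.flatMap fun x => X.map fun y => (x.1 * y.1, listMul cs x.2 y.2)) ++
    (X.filter fun x => x.1 * x.1 = x.1).map fun x =>
      (x.1, listPow cs x.2 E ++ listPow cs x.2 (E + 1)))

/-- A bound on the number of possible values. -/
def valueBound (d : ℕ) (cs : List (AutomatonCode A)) : ℕ :=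
  d * ((2 ^ (stateList cs).length) ^ (stateList cs).length) ^ cs.length

/-- The list of values computed by the algorithm. -/
noncomputable def listSaturation (d : ℕ) (f : A → N) (as : List A)
    (cs : List (AutomatonCode A)) : List (N × List (AutomatonCode A × ℕ × ℕ)) :=
  (listStep (valueBound d cs).factorial cs)^[valueBound d cs] (listInit f as cs)

/-! #### Primitive recursiveness -/

section Primrec

variable [Primcodable A]

theorem primrec_stateList : Primrec (stateList (A := A)) := by
  refine Primrec.list_flatMap Primrec.id (Primrec.list_append.comp ?_
    (Primrec.list_append.comp ?_ (Primrec.list_append.comp ?_ ?_)))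
  · exact Primrec.list_map (Primrec.fst.comp Primrec.snd) (Primrec.fst.comp Primrec.snd)
  · exact Primrec.list_map (Primrec.fst.comp Primrec.snd)
      (Primrec.snd.comp (Primrec.snd.comp Primrec.snd))
  · exact Primrec.fst.comp (Primrec.snd.comp Primrec.snd)
  · exact Primrec.snd.comp (Primrec.snd.comp Primrec.snd)

theorem primrec_triples : Primrec (triples (A := A)) := by
  refine Primrec.list_flatMap Primrec.id (Primrec.list_flatMap (primrec_stateList.comp Primrec.fst)
    (Primrec.list_map (primrec_stateList.comp (Primrec.fst.comp Primrec.fst)) ?_))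
  exact (Primrec.snd.comp (Primrec.fst.comp Primrec.fst)).pair
    ((Primrec.snd.comp Primrec.fst).pair Primrec.snd)

theorem primrecRel_mem {α : Type*} [Primcodable α] : PrimrecRel fun (a : α) (l : List α) => a ∈ l :=
  (PrimrecRel.exists_mem_list (R := fun x a : α => x = a) Primrec.eq).swap.of_eq fun a l => by
    simp [Function.swap]

theorem primrec_listOne : Primrec (listOne (A := A)) := by
  classical
  exact Primrec.listFilter (p := fun x : AutomatonCode A × ℕ × ℕ => x.2.1 = x.2.2)
    (Primrec.eq.comp (Primrec.fst.comp Primrec.snd) (Primrec.snd.comp Primrec.snd))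
    |>.comp primrec_triples

theorem primrec_listLetter : Primrec₂ (listLetter (A := A)) := by
  classical
  have h : PrimrecRel fun (x : AutomatonCode A × ℕ × ℕ) (a : A) => (x.2.1, a, x.2.2) ∈ x.1.1 :=
    primrecRel_mem.comp ((Primrec.fst.comp (Primrec.snd.comp Primrec.fst)).pair
      (Primrec.snd.pair (Primrec.snd.comp (Primrec.snd.comp Primrec.fst))))
      (Primrec.fst.comp (Primrec.fst.comp Primrec.fst))
  exact h.listFilter.comp (primrec_triples.comp Primrec.fst) Primrec.snd

theorem primrec_listMul : Primrec fun x : List (AutomatonCode A) ×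
    List (AutomatonCode A × ℕ × ℕ) × List (AutomatonCode A × ℕ × ℕ) =>
      listMul x.1 x.2.1 x.2.2 := by
  classical
  have h₀ : PrimrecRel fun (m : ℕ) (z : (AutomatonCode A × ℕ × ℕ) × (List (AutomatonCode A) ×
      List (AutomatonCode A × ℕ × ℕ) × List (AutomatonCode A × ℕ × ℕ))) =>
      (z.1.1, z.1.2.1, m) ∈ z.2.2.1 ∧ (z.1.1, m, z.1.2.2) ∈ z.2.2.2 := by
    have hx : Primrec fun y : ℕ × ((AutomatonCode A × ℕ × ℕ) × (List (AutomatonCode A) ×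
      List (AutomatonCode A × ℕ × ℕ) × List (AutomatonCode A × ℕ × ℕ))) => y.2.1 :=
      Primrec.fst.comp Primrec.snd
    have hl : Primrec fun y : ℕ × ((AutomatonCode A × ℕ × ℕ) × (List (AutomatonCode A) ×
      List (AutomatonCode A × ℕ × ℕ) × List (AutomatonCode A × ℕ × ℕ))) => y.2.2.2 :=
      Primrec.snd.comp (Primrec.snd.comp Primrec.snd)
    exact PrimrecPred.and
      (primrecRel_mem.comp ((Primrec.fst.comp hx).pair
        ((Primrec.fst.comp (Primrec.snd.comp hx)).pair Primrec.fst)) (Primrec.fst.comp hl))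
      (primrecRel_mem.comp ((Primrec.fst.comp hx).pair
        (Primrec.fst.pair (Primrec.snd.comp (Primrec.snd.comp hx)))) (Primrec.snd.comp hl))
  have h : PrimrecRel fun (x : AutomatonCode A × ℕ × ℕ) (z : List (AutomatonCode A) ×
      List (AutomatonCode A × ℕ × ℕ) × List (AutomatonCode A × ℕ × ℕ)) =>
      ∃ m ∈ stateList z.1, (x.1, x.2.1, m) ∈ z.2.1 ∧ (x.1, m, x.2.2) ∈ z.2.2 :=
    h₀.exists_mem_list.comp (primrec_stateList.comp (Primrec.fst.comp Primrec.snd)) Primrec.id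
  exact h.listFilter.comp (primrec_triples.comp Primrec.fst) Primrec.id

theorem primrec_listPow : Primrec fun x : List (AutomatonCode A) ×
    List (AutomatonCode A × ℕ × ℕ) × ℕ => listPow x.1 x.2.1 x.2.2 := by
  refine Primrec.nat_iterate (Primrec.snd.comp Primrec.snd) (primrec_listOne.comp Primrec.fst) ?_
  exact primrec_listMul.comp ((Primrec.fst.comp Primrec.fst).pair
    ((Primrec.fst.comp (Primrec.snd.comp Primrec.fst)).pair Primrec.snd))

variable [Primcodable N]

theorem primrec_listInit (f : A → N) (hf : Primrec f) (as : List A) : Primrec (listInit f as) := by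
  refine Primrec.list_cons.comp ((Primrec.const 1).pair primrec_listOne)
    (Primrec.list_map (Primrec.const as) ?_)
  exact (hf.comp Primrec.snd).pair (primrec_listLetter.comp Primrec.fst Primrec.snd)

variable [Finite N]

theorem primrec_listStep : Primrec fun x : ℕ × List (AutomatonCode A) ×
    List (N × List (AutomatonCode A × ℕ × ℕ)) => listStep x.1 x.2.1 x.2.2 := by
  classical
  have hX : Primrec fun x : ℕ × List (AutomatonCode A) ×
    List (N × List (AutomatonCode A × ℕ × ℕ)) => x.2.2 := Primrec.snd.comp Primrec.snd
  refine Primrec.list_append.comp hX (Primrec.list_append.comp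
    (Primrec.list_flatMap hX (Primrec.list_map (hX.comp Primrec.fst) ?_)) (Primrec.list_map ?_ ?_))
  · refine ((Primrec.dom_finite fun t : N × N => t.1 * t.2).comp
      ((Primrec.fst.comp (Primrec.snd.comp Primrec.fst)).pair
        (Primrec.fst.comp Primrec.snd))).pair (primrec_listMul.comp (Primrec.pair ?_
          ((Primrec.snd.comp (Primrec.snd.comp Primrec.fst)).pair (Primrec.snd.comp Primrec.snd))))
    exact Primrec.fst.comp (Primrec.snd.comp (Primrec.fst.comp Primrec.fst))
  · refine Primrec.comp (Primrec.listFilter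
      (p := fun x : N × List (AutomatonCode A × ℕ × ℕ) => x.1 * x.1 = x.1) ?_) hX
    exact Primrec.eq.comp ((Primrec.dom_finite fun t : N => t * t).comp Primrec.fst) Primrec.fst
  · have hE : Primrec fun y : (ℕ × List (AutomatonCode A) ×
      List (N × List (AutomatonCode A × ℕ × ℕ))) × (N × List (AutomatonCode A × ℕ × ℕ)) => y.1.1 :=
      Primrec.fst.comp Primrec.fst
    have hcs : Primrec fun y : (ℕ × List (AutomatonCode A) ×
      List (N × List (AutomatonCode A × ℕ × ℕ))) × (N × List (AutomatonCode A × ℕ × ℕ)) =>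
      y.1.2.1 := Primrec.fst.comp (Primrec.snd.comp Primrec.fst)
    have hl : Primrec fun y : (ℕ × List (AutomatonCode A) ×
      List (N × List (AutomatonCode A × ℕ × ℕ))) × (N × List (AutomatonCode A × ℕ × ℕ)) =>
      y.2.2 := Primrec.snd.comp Primrec.snd
    exact (Primrec.fst.comp Primrec.snd).pair (Primrec.list_append.comp
      (primrec_listPow.comp (hcs.pair (hl.pair hE)))
      (primrec_listPow.comp (hcs.pair (hl.pair (Primrec.succ.comp hE)))))

theorem primrec_natPow : Primrec₂ fun m n : ℕ => m ^ n :=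
  ((Primrec.nat_rec (f := fun _ : ℕ => 1) (g := fun m (x : ℕ × ℕ) => x.2 * m) (Primrec.const 1)
    (Primrec.nat_mul.comp (Primrec.snd.comp Primrec.snd) Primrec.fst))).of_eq fun m n => by
      induction n with
      | zero => rfl
      | succ n ih => rw [pow_succ, ← ih]

theorem primrec_factorial : Primrec Nat.factorial :=
  (Primrec.nat_rec₁ (f := fun n x => (n + 1) * x) 1 (Primrec.nat_mul.comp
    (Primrec.succ.comp Primrec.fst) Primrec.snd)).of_eq fun n => by
      induction n with
      | zero => rfl
      | succ n ih => rw [Nat.factorial_succ, ← ih]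

theorem primrec_valueBound (d : ℕ) : Primrec (valueBound (A := A) d) := by
  have hs := Primrec.list_length.comp (primrec_stateList (A := A))
  exact Primrec.nat_mul.comp (Primrec.const d) (primrec_natPow.comp (primrec_natPow.comp
    (primrec_natPow.comp (Primrec.const 2) hs) hs) Primrec.list_length)

theorem primrec_listSaturation (d : ℕ) (f : A → N) (hf : Primrec f) (as : List A) :
    Primrec (listSaturation d f as) := by
  refine Primrec.nat_iterate (primrec_valueBound d) (primrec_listInit f hf as) ?_
  exact primrec_listStep.comp ((primrec_factorial.comp ((primrec_valueBound d).comp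
    Primrec.fst)).pair (Primrec.fst.pair Primrec.snd))

theorem primrecPred_forall_listSaturation (d : ℕ) (f : A → N) (hf : Primrec f) (as : List A) :
    PrimrecPred fun cs : List (AutomatonCode A) => ∀ x ∈ listSaturation d f as cs,
      ∃ c ∈ cs, ∀ p ∈ c.2.1, ∀ q ∈ c.2.2, (c, p, q) ∉ x.2 := by
  have h₀ : PrimrecRel fun (q : ℕ) (z : ℕ × AutomatonCode A × List (AutomatonCode A × ℕ × ℕ)) =>
      (z.2.1, z.1, q) ∉ z.2.2 := by
    refine PrimrecPred.not (primrecRel_mem.comp (Primrec.pair ?_ (Primrec.pair ?_ Primrec.fst)) ?_)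
    · exact Primrec.fst.comp (Primrec.snd.comp Primrec.snd)
    · exact Primrec.fst.comp Primrec.snd
    · exact Primrec.snd.comp (Primrec.snd.comp Primrec.snd)
  have h₁ : PrimrecRel fun (p : ℕ) (z : AutomatonCode A × List (AutomatonCode A × ℕ × ℕ)) =>
      ∀ q ∈ z.1.2.2, (z.1, p, q) ∉ z.2 :=
    h₀.forall_mem_list.comp (Primrec.snd.comp (Primrec.snd.comp (Primrec.fst.comp Primrec.snd)))
      Primrec.id
  have h₂ : PrimrecRel fun (c : AutomatonCode A) (l : List (AutomatonCode A × ℕ × ℕ)) =>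
      ∀ p ∈ c.2.1, ∀ q ∈ c.2.2, (c, p, q) ∉ l :=
    h₁.forall_mem_list.comp (Primrec.fst.comp (Primrec.snd.comp Primrec.fst)) Primrec.id
  have h₃ : PrimrecRel fun (x : N × List (AutomatonCode A × ℕ × ℕ))
      (cs : List (AutomatonCode A)) => ∃ c ∈ cs, ∀ p ∈ c.2.1, ∀ q ∈ c.2.2, (c, p, q) ∉ x.2 :=
    h₂.exists_mem_list.comp Primrec.snd (Primrec.snd.comp Primrec.fst)
  exact h₃.forall_mem_list.comp (primrec_listSaturation d f hf as) Primrec.id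

end Primrec

end AutomatonCode

/-! ### Saturation by iteration -/

section Iteration

/-- Each round before stabilization adds an element. -/
theorem iterate_eq_of_card_le {T : Type*} [Finite T] {Φ : Set T → Set T} (hΦ : ∀ F, F ⊆ Φ F)
    (G : Set T) {n : ℕ} (hn : Nat.card T ≤ n) : Φ (Φ^[n] G) = Φ^[n] G := by
  have key : ∃ k ≤ n, Φ (Φ^[k] G) = Φ^[k] G := by
    by_contra! h
    have : ∀ k ≤ n + 1, k ≤ (Φ^[k] G).ncard := by
      intro k hk
      induction k with
      | zero => exact Nat.zero_le _
      | succ k ih =>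
        rw [Function.iterate_succ_apply']
        exact (ih (by omega)).trans_lt (Set.ncard_lt_ncard
          (Set.ssubset_iff_subset_ne.2 ⟨hΦ _, (h k (by omega)).symm⟩) (Set.toFinite _))
    have h1 := this (n + 1) le_rfl
    have h2 := Set.ncard_le_card (Φ^[n + 1] G)
    omega
  obtain ⟨k, hk, hk'⟩ := key
  have : ∀ m, k ≤ m → Φ^[m] G = Φ^[k] G := by
    intro m hm
    induction m, hm using Nat.le_induction with
    | base => rfl
    | succ m _ ih => rw [Function.iterate_succ_apply', ih, hk']
  rw [this n hk, hk']

/-- By pigeonhole the powers of `x` are periodic from some `i ≤ n ≤ n!` on, with a period `d ≤ n`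
that divides `n!`. This gives an exponent uniform in `x` and computable from the size bound. -/
theorem pow_factorial_mul_self {T : Type*} [Monoid T] [Finite T] {n : ℕ} (hn : Nat.card T ≤ n)
    (x : T) : x ^ n.factorial * x ^ n.factorial = x ^ n.factorial := by
  have : ∃ i j : Fin (n + 1), i ≠ j ∧ x ^ (i : ℕ) = x ^ (j : ℕ) := by
    have hni : ¬ Function.Injective fun i : Fin (n + 1) => x ^ (i : ℕ) := by
      intro h
      have := Nat.card_le_card_of_injective _ h
      rw [Nat.card_fin] at this
      omega
    simp only [Function.Injective, not_forall] at hni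
    obtain ⟨i, j, h, h'⟩ := hni
    exact ⟨i, j, h', h⟩
  obtain ⟨i, d, hd, hdn, hid, h⟩ : ∃ i d : ℕ, 0 < d ∧ d ≤ n ∧ i ≤ n ∧ x ^ (i + d) = x ^ i := by
    obtain ⟨i, j, hij, h⟩ := this
    rcases lt_or_gt_of_ne hij with h' | h' <;> rw [Fin.lt_def] at h'
    · exact ⟨i, j - i, by omega, by omega, by omega, by rw [Nat.add_sub_cancel' h'.le, h]⟩
    · exact ⟨j, i - j, by omega, by omega, by omega, by rw [Nat.add_sub_cancel' h'.le, h]⟩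
  have hper : ∀ k, x ^ (i + d * k) = x ^ i := by
    intro k
    induction k with
    | zero => rfl
    | succ k ih => rw [Nat.mul_succ, ← add_assoc, add_right_comm, pow_add, h, ← pow_add, ih]
  obtain ⟨k, hk⟩ := Nat.dvd_factorial hd hdn
  obtain ⟨m, hm⟩ := Nat.exists_eq_add_of_le (hid.trans n.self_le_factorial)
  rw [← pow_add]
  nth_rewrite 1 [hm]
  rw [add_right_comm, pow_add]
  nth_rewrite 1 [hk]
  rw [hper, ← pow_add, ← hm]

variable {N R : Type*} [Monoid N] [Monoid R] [SemilatticeSup R]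

/-- One round of saturation. -/
def saturationStep (E : ℕ) (F : Set (N × R)) : Set (N × R) :=
  {z | z ∈ F ∨ (∃ x ∈ F, ∃ y ∈ F, x * y = z) ∨
    ∃ x ∈ F, IsIdempotentElem x.1 ∧ powerMerge E x = z}

theorem saturation_iff_mem_iterate [Finite N] [Finite R] {E n : ℕ} (hn : Nat.card (N × R) ≤ n)
    (G : Set (N × R)) (x : N × R) : Saturation E G x ↔ x ∈ (saturationStep E)^[n] G := by
  constructor
  · have hfix := iterate_eq_of_card_le (Φ := saturationStep E) (fun F x hx => Or.inl hx) G hn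
    have hsub : ∀ k, G ⊆ (saturationStep E)^[k] G := by
      intro k
      induction k with
      | zero => exact le_rfl
      | succ k ih =>
        rw [Function.iterate_succ_apply']
        exact ih.trans fun x hx => Or.inl hx
    intro h
    induction h with
    | basic x hx => exact hsub n hx
    | mul x y _ _ ihx ihy =>
      rw [← hfix]
      exact Or.inr (Or.inl ⟨x, ihx, y, ihy, rfl⟩)
    | merge x _ hi ih =>
      rw [← hfix]
      exact Or.inr (Or.inr ⟨x, ih, hi, rfl⟩)
  · clear hn
    induction n generalizing x with
    | zero => exact fun h => .basic x h
    | succ n ih =>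
      rw [Function.iterate_succ_apply']
      rintro (h | ⟨y, hy, z, hz, rfl⟩ | ⟨y, hy, hi, rfl⟩)
      exacts [ih x h, (ih y hy).mul _ _ (ih z hz), (ih y hy).merge _ hi]

end Iteration

namespace AutomatonCode

variable {A : Type*}

/-! ### Correctness of the algorithm -/

instance finite_mem_list {α : Type*} (l : List α) : Finite {a // a ∈ l} :=
  l.finite_toSet.to_subtype

theorem card_mem_list_le {α : Type*} (l : List α) : Nat.card {a // a ∈ l} ≤ l.length := by
  have := Nat.card_le_card_of_surjective
    (fun i : Fin l.length => (⟨l[i], by simp⟩ : {a // a ∈ l})) (by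
      rintro ⟨a, ha⟩
      obtain ⟨i, hi, rfl⟩ := List.getElem_of_mem ha
      exact ⟨⟨i, hi⟩, rfl⟩)
  rwa [Nat.card_fin] at this

/-- One computable bound serves twice: as the number of rounds and, through its factorial, as the
exponent `E`. -/
theorem card_values_le {N : Type*} [Finite N] (cs : List (AutomatonCode A)) :
    Nat.card (N × RelFamily {c // c ∈ cs} {q // q ∈ stateList cs}) ≤
      valueBound (Nat.card N) cs := by
  rw [Nat.card_prod, valueBound, RelFamily, Nat.card_fun, Nat.card_fun, Nat.card_fun]
  have h2 : Nat.card Prop = 2 := by simp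
  rw [h2]
  gcongr
  · exact Nat.one_le_pow _ _ (by positivity)
  · exact Nat.one_le_pow _ _ (by norm_num)
  · norm_num
  all_goals exact card_mem_list_le _

/-- The family of relations described by a list of triples. -/
def toFamily (cs : List (AutomatonCode A)) (l : List (AutomatonCode A × ℕ × ℕ)) :
    RelFamily {c // c ∈ cs} {q // q ∈ stateList cs} :=
  fun c p q => (c.1, p.1, q.1) ∈ l

theorem mem_triples_coe {cs : List (AutomatonCode A)} (c : {c // c ∈ cs})
    (p q : {q // q ∈ stateList cs}) : (c.1, p.1, q.1) ∈ triples cs :=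
  mem_triples.2 ⟨c.2, p.2, q.2⟩

theorem toFamily_one (cs : List (AutomatonCode A)) : toFamily cs (listOne cs) = 1 := by
  funext c p q
  simp only [toFamily, listOne, List.mem_filter, mem_triples_coe, true_and, decide_eq_true_eq]
  exact propext Subtype.ext_iff.symm

theorem toFamily_letter (cs : List (AutomatonCode A)) (a : A) (c : {c // c ∈ cs})
    (p q : {q // q ∈ stateList cs}) :
    toFamily cs (listLetter cs a) c p q ↔ (p.1, a, q.1) ∈ c.1.1 := by
  simp only [toFamily, listLetter, List.mem_filter, mem_triples_coe, true_and, decide_eq_true_eq]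

theorem toFamily_mul (cs : List (AutomatonCode A)) (l l' : List (AutomatonCode A × ℕ × ℕ)) :
    toFamily cs (listMul cs l l') = toFamily cs l * toFamily cs l' := by
  funext c p q
  simp only [toFamily, listMul, List.mem_filter, mem_triples_coe, true_and, decide_eq_true_eq]
  refine propext ⟨?_, ?_⟩
  · rintro ⟨m, hm, h, h'⟩
    exact ⟨⟨m, hm⟩, h, h'⟩
  · rintro ⟨m, h, h'⟩
    exact ⟨m.1, m.2, h, h'⟩

theorem toFamily_append (cs : List (AutomatonCode A)) (l l' : List (AutomatonCode A × ℕ × ℕ)) :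
    toFamily cs (l ++ l') = toFamily cs l ⊔ toFamily cs l' := by
  funext c p q
  simp only [toFamily, List.mem_append]
  rfl

theorem toFamily_pow (cs : List (AutomatonCode A)) (l : List (AutomatonCode A × ℕ × ℕ)) (k : ℕ) :
    toFamily cs (listPow cs l k) = toFamily cs l ^ k := by
  induction k with
  | zero => exact toFamily_one cs
  | succ k ih =>
    rw [listPow, Function.iterate_succ_apply', toFamily_mul, pow_succ', ← ih]
    rfl

variable {N : Type*} [Monoid N]

/-- The set of values described by a list. -/
def toValues (cs : List (AutomatonCode A)) (X : List (N × List (AutomatonCode A × ℕ × ℕ))) :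
    Set (N × RelFamily {c // c ∈ cs} {q // q ∈ stateList cs}) :=
  {z | ∃ x ∈ X, (x.1, toFamily cs x.2) = z}

theorem toValues_init (f : A → N) {as : List A} (has : ∀ a, a ∈ as) (cs : List (AutomatonCode A)) :
    toValues cs (listInit f as cs) =
      insert 1 (Set.range fun a => (f a, toFamily cs (listLetter cs a))) := by
  ext z
  simp only [toValues, listInit, List.mem_cons, List.mem_map]
  constructor
  · rintro ⟨_, rfl | ⟨a, -, rfl⟩, rfl⟩
    · exact Or.inl (Prod.ext rfl (toFamily_one cs))
    · exact Or.inr ⟨a, rfl⟩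
  · rintro (rfl | ⟨a, rfl⟩)
    · exact ⟨_, Or.inl rfl, Prod.ext rfl (toFamily_one cs)⟩
    · exact ⟨_, Or.inr ⟨a, has a, rfl⟩, rfl⟩

theorem toValues_step (E : ℕ) (cs : List (AutomatonCode A))
    (X : List (N × List (AutomatonCode A × ℕ × ℕ))) :
    toValues cs (listStep E cs X) = saturationStep E (toValues cs X) := by
  have hmerge : ∀ x : N × List (AutomatonCode A × ℕ × ℕ),
      (x.1, toFamily cs (listPow cs x.2 E ++ listPow cs x.2 (E + 1))) =
        powerMerge E (x.1, toFamily cs x.2) := fun x => by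
    rw [toFamily_append, toFamily_pow, toFamily_pow]
    rfl
  have hmul : ∀ x y : N × List (AutomatonCode A × ℕ × ℕ),
      (x.1 * y.1, toFamily cs (listMul cs x.2 y.2)) =
        (x.1, toFamily cs x.2) * (y.1, toFamily cs y.2) := fun x y => by
    rw [toFamily_mul]
    rfl
  ext z
  simp only [toValues, listStep, List.mem_append, List.mem_flatMap, List.mem_map, List.mem_filter,
    decide_eq_true_eq]
  constructor
  · rintro ⟨_, hx | ⟨x, hx, y, hy, rfl⟩ | ⟨x, ⟨hx, hi⟩, rfl⟩, rfl⟩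
    · exact Or.inl ⟨_, hx, rfl⟩
    · exact Or.inr (Or.inl ⟨_, ⟨x, hx, rfl⟩, _, ⟨y, hy, rfl⟩, (hmul x y).symm⟩)
    · exact Or.inr (Or.inr ⟨_, ⟨x, hx, rfl⟩, hi, (hmerge x).symm⟩)
  · rintro (⟨x, hx, rfl⟩ | ⟨_, ⟨x, hx, rfl⟩, _, ⟨y, hy, rfl⟩, rfl⟩ | ⟨_, ⟨x, hx, rfl⟩, hi, rfl⟩)
    · exact ⟨_, Or.inl hx, rfl⟩
    · exact ⟨_, Or.inr (Or.inl ⟨x, hx, y, hy, rfl⟩), hmul x y⟩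
    · exact ⟨_, Or.inr (Or.inr ⟨x, ⟨hx, hi⟩, rfl⟩), hmerge x⟩

theorem mem_toValues_listSaturation_iff [Finite N] (f : A → N) {as : List A} (has : ∀ a, a ∈ as)
    (cs : List (AutomatonCode A))
    (z : N × RelFamily {c // c ∈ cs} {q // q ∈ stateList cs}) :
    z ∈ toValues cs (listSaturation (Nat.card N) f as cs) ↔
      Saturation (valueBound (Nat.card N) cs).factorial
        (insert 1 (Set.range fun a => (f a, toFamily cs (listLetter cs a)))) z := by
  rw [saturation_iff_mem_iterate (card_values_le cs), ← toValues_init f has, listSaturation]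
  have : ∀ k, toValues cs ((listStep (valueBound (Nat.card N) cs).factorial cs)^[k]
      (listInit f as cs)) = (saturationStep (valueBound (Nat.card N) cs).factorial)^[k]
        (toValues cs (listInit f as cs)) := by
    intro k
    induction k with
    | zero => rfl
    | succ k ih => rw [Function.iterate_succ_apply', Function.iterate_succ_apply', toValues_step, ih]
  rw [this]

theorem mem_stateList {cs : List (AutomatonCode A)} {c : AutomatonCode A} (hc : c ∈ cs) {q : ℕ}
    (hq : (∃ a r, (q, a, r) ∈ c.1) ∨ (∃ p a, (p, a, q) ∈ c.1) ∨ q ∈ c.2.1 ∨ q ∈ c.2.2) :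
    q ∈ stateList cs := by
  simp only [stateList, List.mem_flatMap, List.mem_append, List.mem_map]
  refine ⟨c, hc, ?_⟩
  rcases hq with ⟨a, r, h⟩ | ⟨p, a, h⟩ | h | h
  exacts [Or.inl ⟨_, h, rfl⟩, Or.inr (Or.inl ⟨_, h, rfl⟩), Or.inr (Or.inr (Or.inl h)),
    Or.inr (Or.inr (Or.inr h))]

/-- A run from a listed state never leaves the finite list, so the automaton on `ℕ` may be replaced
by finite relations. -/
theorem mem_evalFrom_iff_prod {cs : List (AutomatonCode A)} (c : {c // c ∈ cs}) (w : List A)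
    (p : {q // q ∈ stateList cs}) (q : ℕ) : q ∈ c.1.toNFA.evalFrom {p.1} w ↔
      ∃ hq : q ∈ stateList cs,
        (w.map fun a => toFamily cs (listLetter cs a)).prod c p ⟨q, hq⟩ := by
  induction w generalizing p with
  | nil =>
    rw [NFA.evalFrom_nil, List.map_nil, List.prod_nil]
    constructor
    · rintro rfl
      exact ⟨p.2, rfl⟩
    · rintro ⟨hq, h⟩
      exact (congrArg Subtype.val (show p = ⟨q, hq⟩ from h)).symm
  | cons a w ih =>
    rw [NFA.evalFrom_cons, NFA.stepSet_singleton, NFA.mem_evalFrom_iff_exists, List.map_cons,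
      List.prod_cons]
    constructor
    · rintro ⟨m, hm, h⟩
      have hm' : (p.1, a, m) ∈ c.1.1 := hm
      have hms := mem_stateList c.2 (Or.inr (Or.inl ⟨_, _, hm'⟩))
      obtain ⟨hq, h'⟩ := (ih ⟨m, hms⟩).1 h
      exact ⟨hq, ⟨m, hms⟩, (toFamily_letter cs a c p ⟨m, hms⟩).2 hm', h'⟩
    · rintro ⟨hq, m, h, h'⟩
      exact ⟨m.1, (toFamily_letter cs a c p m).1 h, (ih m).2 ⟨hq, h'⟩⟩

theorem familyLanguage_eq_language {cs : List (AutomatonCode A)} (c : {c // c ∈ cs}) :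
    familyLanguage (fun a => toFamily cs (listLetter cs a)) (fun c => {p | p.1 ∈ c.1.2.1})
      (fun c => {q | q.1 ∈ c.1.2.2}) c = c.1.language := by
  refine Language.ext fun w => ?_
  rw [language, NFA.mem_accepts]
  constructor
  · rintro ⟨p, hp, q, hq, h⟩
    exact ⟨q.1, hq, NFA.mem_evalFrom_iff_exists.2
      ⟨p.1, hp, (mem_evalFrom_iff_prod c w p q.1).2 ⟨q.2, h⟩⟩⟩
  · rintro ⟨q, hq, h⟩
    obtain ⟨p, hp, h'⟩ := NFA.mem_evalFrom_iff_exists.1 h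
    have hps := mem_stateList c.2 (Or.inr (Or.inr (Or.inl hp)))
    obtain ⟨hqs, h''⟩ := (mem_evalFrom_iff_prod c w ⟨p, hps⟩ q).1 h'
    exact ⟨⟨p, hps⟩, hp, ⟨q, hqs⟩, hq, h''⟩

theorem isCoverable_iff_listSaturation [Finite A] [Finite N] (f : A → N) {as : List A}
    (has : ∀ a, a ∈ as) (c₁ : AutomatonCode A) (cs : List (AutomatonCode A)) :
    IsCoverable (starFreeClosure (productClass f)) c₁.language {L | ∃ c ∈ cs, c.language = L} ↔
      ∀ x ∈ listSaturation (Nat.card N) f as (c₁ :: cs),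
        ∃ c ∈ c₁ :: cs, ∀ p ∈ c.2.1, ∀ q ∈ c.2.2, (c, p, q) ∉ x.2 := by
  have h := isCoverable_iff_forall_saturation (Nat.factorial_pos _)
    (pow_factorial_mul_self (card_values_le (N := N) (c₁ :: cs))) f
    (fun a => toFamily (c₁ :: cs) (listLetter (c₁ :: cs) a)) (fun c => {p | p.1 ∈ c.1.2.1})
    -- Indices are codes rather than positions: `c₁` may recur in `cs`, and then it is both the
    -- distinguished index and a member of `J`.
    (fun c => {q | q.1 ∈ c.1.2.2}) ⟨c₁, List.mem_cons_self⟩ {c | c.1 ∈ cs}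
    (fun c => (List.mem_cons.1 c.2).imp_left Subtype.ext)
  rw [familyLanguage_eq_language] at h
  have himage : (familyLanguage (fun a => toFamily (c₁ :: cs) (listLetter (c₁ :: cs) a))
      (fun c => {p | p.1 ∈ c.1.2.1}) fun c => {q | q.1 ∈ c.1.2.2}) '' {c | c.1 ∈ cs} =
      {L | ∃ c ∈ cs, c.language = L} := by
    ext L
    constructor
    · rintro ⟨c, hc, rfl⟩
      exact ⟨c.1, hc, (familyLanguage_eq_language c).symm⟩
    · rintro ⟨c, hc, rfl⟩
      exact ⟨⟨c, List.mem_cons_of_mem _ hc⟩, hc, familyLanguage_eq_language _⟩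
  rw [himage] at h
  rw [h]
  simp only [← mem_toValues_listSaturation_iff f has]
  constructor
  · intro H x hx
    obtain ⟨c, hc⟩ := H _ ⟨x, hx, rfl⟩
    refine ⟨c.1, c.2, fun p hp q hq => ?_⟩
    exact hc ⟨p, mem_stateList c.2 (Or.inr (Or.inr (Or.inl hp)))⟩ hp
      ⟨q, mem_stateList c.2 (Or.inr (Or.inr (Or.inr hq)))⟩ hq
  · rintro H _ ⟨x, hx, rfl⟩
    obtain ⟨c, hc, hc'⟩ := H x hx
    exact ⟨⟨c, hc⟩, fun p hp q hq => hc' p.1 hp q.1 hq⟩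

theorem coveringDecidable_productClass [Finite A] [Primcodable A] [Finite N] (f : A → N) :
    CoveringDecidable (starFreeClosure (productClass f)) := by
  obtain ⟨n, ⟨e⟩⟩ := Finite.exists_equiv_fin N
  let _ : Primcodable N := Primcodable.ofEquiv (Fin n) e
  have := Fintype.ofFinite A
  have has : ∀ a : A, a ∈ (Finset.univ : Finset A).toList := fun a => by simp
  refine PrimrecPred.computablePred (PrimrecPred.of_eq
    ((primrecPred_forall_listSaturation (Nat.card N) f (Primrec.dom_finite f)
      (Finset.univ : Finset A).toList).comp (Primrec.list_cons.comp Primrec.fst Primrec.snd))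
    fun p => (isCoverable_iff_listSaturation f has p.1 p.2).symm)

end AutomatonCode

/-! ### Complementation of codes -/

namespace AutomatonCode

variable {A : Type*}

/-- All sublists of a list. -/
def subLists (l : List ℕ) : List (List ℕ) :=
  l.foldr (fun q ls => ls ++ ls.map fun t => q :: t) [[]]

/-- Filtering a fixed list gives canonical representatives for the state sets reached in the subset
construction. -/
theorem filter_mem_subLists (P : ℕ → Bool) (l : List ℕ) : l.filter P ∈ subLists l := by
  induction l with
  | nil => exact List.mem_singleton.2 rfl
  | cons q l ih =>
    have h : subLists (q :: l) = subLists l ++ (subLists l).map fun t => q :: t := rfl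
    rw [h, List.filter_cons]
    split_ifs
    · exact List.mem_append_right _ (List.mem_map.2 ⟨_, ih, rfl⟩)
    · exact List.mem_append_left _ ih

open Classical in
/-- The successors of a list of states. -/
noncomputable def nextStates (c : AutomatonCode A) (T : List ℕ) (a : A) : List ℕ :=
  (stateList [c]).filter fun q => ∃ p ∈ T, (p, a, q) ∈ c.1

open Classical in
/-- The subset construction, accepting the complement. -/
noncomputable def complement (as : List A) (c : AutomatonCode A) : AutomatonCode A :=
  ((subLists (stateList [c])).flatMap fun T =>
      as.map fun a => (Encodable.encode T, a, Encodable.encode (nextStates c T a)),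
    [Encodable.encode ((stateList [c]).filter fun q => q ∈ c.2.1)],
    ((subLists (stateList [c])).filter fun T => ∀ q ∈ T, q ∉ c.2.2).map Encodable.encode)

theorem primrec_subLists : Primrec subLists := by
  have h : Primrec fun x : List ℕ × ℕ × List (List ℕ) =>
      x.2.2 ++ x.2.2.map fun t => x.2.1 :: t :=
    Primrec.list_append.comp (Primrec.snd.comp Primrec.snd)
      (Primrec.list_map (Primrec.snd.comp Primrec.snd) (Primrec.list_cons.comp
        (Primrec.fst.comp (Primrec.snd.comp Primrec.fst)) Primrec.snd))
  have h' : Primrec₂ fun (_ : List ℕ) (x : ℕ × List (List ℕ)) =>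
      x.2 ++ x.2.map fun t => x.1 :: t := h
  exact Primrec.list_foldr Primrec.id (Primrec.const [[]]) h'

theorem primrec_nextStates [Primcodable A] :
    Primrec fun x : AutomatonCode A × List ℕ × A => nextStates x.1 x.2.1 x.2.2 := by
  classical
  have h₀ : PrimrecRel fun (p : ℕ) (z : ℕ × AutomatonCode A × List ℕ × A) =>
      (p, z.2.2.2, z.1) ∈ z.2.1.1 :=
    primrecRel_mem.comp (Primrec.fst.pair
      ((Primrec.snd.comp (Primrec.snd.comp (Primrec.snd.comp Primrec.snd))).pair
        (Primrec.fst.comp Primrec.snd)))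
      (Primrec.fst.comp (Primrec.fst.comp (Primrec.snd.comp Primrec.snd)))
  have h : PrimrecRel fun (q : ℕ) (z : AutomatonCode A × List ℕ × A) =>
      ∃ p ∈ z.2.1, (p, z.2.2, q) ∈ z.1.1 :=
    h₀.exists_mem_list.comp (Primrec.fst.comp (Primrec.snd.comp Primrec.snd)) Primrec.id
  exact h.listFilter.comp (primrec_stateList.comp (Primrec.list_cons.comp Primrec.fst
    (Primrec.const []))) Primrec.id

theorem primrec_complement [Primcodable A] (as : List A) : Primrec (complement as) := by
  classical
  have hS : Primrec fun c : AutomatonCode A => stateList [c] :=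
    primrec_stateList.comp (Primrec.list_cons.comp Primrec.id (Primrec.const []))
  have hsub := primrec_subLists.comp hS
  refine Primrec.pair (Primrec.list_flatMap hsub (Primrec.list_map (Primrec.const as) ?_))
    (Primrec.pair (Primrec.list_cons.comp (Primrec.encode.comp ?_) (Primrec.const []))
      (Primrec.list_map ?_ (Primrec.encode.comp Primrec.snd)))
  · exact (Primrec.encode.comp (Primrec.snd.comp Primrec.fst)).pair (Primrec.snd.pair
      (Primrec.encode.comp (primrec_nextStates.comp ((Primrec.fst.comp Primrec.fst).pair
        ((Primrec.snd.comp Primrec.fst).pair Primrec.snd)))))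
  · exact (primrecRel_mem (α := ℕ)).listFilter.comp hS (Primrec.fst.comp Primrec.snd)
  · have h : PrimrecRel fun (T : List ℕ) (c : AutomatonCode A) => ∀ q ∈ T, q ∉ c.2.2 :=
      PrimrecRel.forall_mem_list (R := fun (q : ℕ) (c : AutomatonCode A) => q ∉ c.2.2)
        (PrimrecPred.not (primrecRel_mem.comp Primrec.fst
          (Primrec.snd.comp (Primrec.snd.comp Primrec.snd))))
    exact h.listFilter.comp hsub Primrec.id

theorem mem_nextStates {c : AutomatonCode A} {T : List ℕ} {a : A} {q : ℕ} :
    q ∈ nextStates c T a ↔ ∃ p ∈ T, (p, a, q) ∈ c.1 := by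
  simp only [nextStates, List.mem_filter, decide_eq_true_eq, and_iff_right_iff_imp]
  rintro ⟨p, -, h⟩
  exact mem_stateList (List.mem_singleton.2 rfl) (Or.inr (Or.inl ⟨_, _, h⟩))

theorem complement_stepSet {as : List A} (has : ∀ a, a ∈ as) (c : AutomatonCode A) {T : List ℕ}
    (hT : T ∈ subLists (stateList [c])) (a : A) :
    (complement as c).toNFA.stepSet {Encodable.encode T} a =
      {Encodable.encode (nextStates c T a)} := by
  rw [NFA.stepSet_singleton]
  ext q
  refine List.mem_flatMap.trans ⟨?_, ?_⟩
  · rintro ⟨T', hT', h⟩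
    obtain ⟨a', -, h'⟩ := List.mem_map.1 h
    simp only [Prod.mk.injEq] at h'
    obtain ⟨h1, rfl, rfl⟩ := h'
    rw [Encodable.encode_injective h1]
    rfl
  · rintro rfl
    exact ⟨T, hT, List.mem_map.2 ⟨a, has a, rfl⟩⟩

theorem complement_evalFrom {as : List A} (has : ∀ a, a ∈ as) (c : AutomatonCode A) (w : List A) :
    ∀ T ∈ subLists (stateList [c]), ∃ T' ∈ subLists (stateList [c]),
      (complement as c).toNFA.evalFrom {Encodable.encode T} w = {Encodable.encode T'} ∧
      ∀ q, q ∈ T' ↔ q ∈ c.toNFA.evalFrom {p | p ∈ T} w := by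
  induction w with
  | nil => exact fun T hT => ⟨T, hT, rfl, fun q => Iff.rfl⟩
  | cons a w ih =>
    intro T hT
    obtain ⟨T', hT', h, h'⟩ := ih (nextStates c T a) (filter_mem_subLists _ _)
    refine ⟨T', hT', by rw [NFA.evalFrom_cons, complement_stepSet has c hT, h], fun q => ?_⟩
    have : c.toNFA.stepSet {p | p ∈ T} a = {p | p ∈ nextStates c T a} := by
      ext q
      exact NFA.mem_stepSet.trans mem_nextStates.symm
    rw [h', NFA.evalFrom_cons, this]

theorem complement_language {as : List A} (has : ∀ a, a ∈ as) (c : AutomatonCode A) :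
    (complement as c).language = c.languageᶜ := by
  classical
  refine Language.ext fun w => ?_
  obtain ⟨T', hT', h, h'⟩ := complement_evalFrom has c w _
    (filter_mem_subLists (fun q => q ∈ c.2.1) (stateList [c]))
  have hstart : {p | p ∈ (stateList [c]).filter fun q => q ∈ c.2.1} = c.toNFA.start := by
    ext p
    simp only [List.mem_filter, decide_eq_true_eq]
    exact and_iff_right_of_imp fun hp =>
      mem_stateList (List.mem_singleton.2 rfl) (Or.inr (Or.inr (Or.inl hp)))
  have hstart' : (complement as c).toNFA.start =
      {Encodable.encode ((stateList [c]).filter fun q => q ∈ c.2.1)} := by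
    ext q
    simp [toNFA, complement]
  have hacc : w ∈ (complement as c).language ↔ ∀ q ∈ T', q ∉ c.2.2 := by
    rw [language, NFA.mem_accepts, hstart', h]
    constructor
    · rintro ⟨_, hq, rfl⟩
      obtain ⟨T, hT, hTT⟩ := List.mem_map.1 hq
      obtain rfl := Encodable.encode_injective hTT
      simpa using (List.mem_filter.1 hT).2
    · intro hq
      exact ⟨_, List.mem_map.2 ⟨T', List.mem_filter.2 ⟨hT', by simpa using hq⟩, rfl⟩, rfl⟩
  rw [hacc]
  simp only [h', hstart]
  constructor
  · intro H hw
    obtain ⟨q, hq, hq'⟩ := NFA.mem_accepts.1 hw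
    exact H q hq' hq
  · exact fun H q hq hq' => H (NFA.mem_accepts.2 ⟨q, hq', hq⟩)

end AutomatonCode

/-! ### Reductions between the decision problems -/

section Decidability

variable {A : Type*} [Primcodable A]

theorem ComputablePred.comp_primrec {α β : Type*} [Primcodable α] [Primcodable β] {p : β → Prop}
    (hp : ComputablePred p) {f : α → β} (hf : Primrec f) : ComputablePred fun a => p (f a) := by
  obtain ⟨_, h⟩ := hp
  exact ⟨fun a => inferInstance, h.comp hf.to_comp⟩

theorem SeparationDecidable.of_covering {C : Set (Language A)} (hne : (starFreeClosure C).Nonempty)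
    (h : CoveringDecidable (starFreeClosure C)) : SeparationDecidable (starFreeClosure C) := by
  refine (ComputablePred.comp_primrec h (Primrec.fst.pair
    (Primrec.list_cons.comp Primrec.snd (Primrec.const [])))).of_eq fun p => ?_
  rw [isClassSeparable_iff_isCoverable hne]
  simp only [List.mem_singleton, exists_eq_left]
  rw [show {L | p.2.language = L} = ({p.2.language} : Set (Language A)) from
    Set.ext fun L => eq_comm]

theorem MembershipDecidable.of_separation [Finite A] {D : Set (Language A)}
    (h : SeparationDecidable D) : MembershipDecidable D := by
  have := Fintype.ofFinite A
  have has : ∀ a : A, a ∈ (Finset.univ : Finset A).toList := fun a => by simp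
  refine (ComputablePred.comp_primrec h (Primrec.id.pair
    (AutomatonCode.primrec_complement (Finset.univ : Finset A).toList))).of_eq fun c => ?_
  rw [mem_iff_isClassSeparable_compl, ← AutomatonCode.complement_language has]
  rfl

theorem coveringDecidable_starFreeLanguages [Finite A] :
    CoveringDecidable (starFreeLanguages A) := by
  rw [starFreeLanguages_eq]
  exact AutomatonCode.coveringDecidable_productClass _

/-- Covering for the empty class asks whether the first language is empty, as does star-free
covering against no languages. -/
theorem coveringDecidable_empty [Finite A] : CoveringDecidable (∅ : Set (Language A)) := by
  refine (ComputablePred.comp_primrec (coveringDecidable_starFreeLanguages (A := A))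
    (Primrec.fst.pair (Primrec.const []))).of_eq fun p => ?_
  rw [isCoverable_empty_iff, ← isCoverable_nil_iff (starFreeLanguages A)]
  simp

theorem separationDecidable_empty : SeparationDecidable (∅ : Set (Language A)) :=
  (Primrec.const false).to_comp.computablePred (p := fun _ => False) |>.of_eq fun p => by
    simp [IsClassSeparable]

end Decidability

/-- `Primcodable A` fixes an encoding of the letters, so that automata can be given to algorithms;
every finite type has such an encoding, and all of them are computably equivalent. -/
theorem theorem1 {A : Type*} [Finite A] [Primcodable A] :
    (∀ C : Set (Language A), C.Finite → IsBooleanAlgebraClass C → IsQuotientClosed C →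
      MembershipDecidable (starFreeClosure C) ∧
      SeparationDecidable (starFreeClosure C) ∧
      CoveringDecidable (starFreeClosure C)) ∧
    CoveringDecidable (starFreeLanguages A) := by
  refine ⟨fun C hfin _ hC => ?_, coveringDecidable_starFreeLanguages⟩
  have key : SeparationDecidable (starFreeClosure C) ∧ CoveringDecidable (starFreeClosure C) := by
    -- An empty closure arises only from empty `C` and an empty alphabet; it is not the closure of
    -- any product class.
    rcases Set.eq_empty_or_nonempty (starFreeClosure C) with h | hne
    · rw [h]
      exact ⟨separationDecidable_empty, coveringDecidable_empty⟩
    · have hcov : CoveringDecidable (starFreeClosure C) := by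
        obtain ⟨N, _, _, f, h⟩ := exists_starFreeClosure_eq_productClass hfin hC hne
        rw [h]
        exact AutomatonCode.coveringDecidable_productClass f
      exact ⟨.of_covering hne hcov, hcov⟩
  exact ⟨.of_separation key.1, key⟩
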